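/- Conventions. All rings except $A',B'$ below are associative and unital; tensor products are over the indicated (noncommutative) rings. Let $\alpha:R\to A$ and $\beta:S\to B$ be ring maps; $A$- and $B$-modules are regarded as $R$- and $S$-modules through $\alpha$, $\beta$. A *$B$-$A$ herd* consists of a $B$-$A$ bimodule $T$, an $A$-$B$ bimodule $\widehat T$ with an $A$-bimodule map $\mathrm{ev}:\widehat T\otimes_S T\to A$ and a $B$-bimodule map $\widehat{\mathrm{ev}}:T\otimes_R\widehat T\to B$ such that $$\widehat{\mathrm{ev}}(x\otimes\hat x)\,y=x\,\mathrm{ev}(\hat x\otimes y),\qquad \hat x\,\widehat{\mathrm{ev}}(x\otimes\hat y)=\mathrm{ev}(\hat x\otimes x)\,\hat y ,$$ and an $S$-$R$ bimodule map $\gamma:T\to T\otimes_R\widehat T\otimes_S T$ such that $(\widehat{\mathrm{ev}}\otimes_S T)\gamma(x)=1_B\otimes x$, $(T\otimes_R\mathrm{ev})\gamma(x)=x\otimes 1_A$ and $(\gamma\otimes_R\widehat T\otimes_S T)\gamma=(T\otimes_R\widehat T\otimes_S\gamma)\gamma$. The herd is *tame* if $\mathrm{ev}$ and $\widehat{\mathrm{ev}}$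 are surjective and $T$ is faithfully flat as a right $R$-module and as a left $S$-module. Let $C\subseteq\widehat T\otimes_S T$ be the equaliser of $(\mathrm{ev}\otimes\widehat T\otimes T)(\widehat T\otimes\gamma)$ and $\alpha\otimes\widehat T\otimes T$ (maps to $A\otimes_R\widehat T\otimes_S T$), let $D\subseteq T\otimes_R\widehat T$ be the equaliser of $(T\otimes\widehat T\otimes\widehat{\mathrm{ev}})(\gamma\otimes\widehat T)$ and $T\otimes\widehat T\otimes\beta$ (maps to $T\otimes_R\widehat T\otimes_S B$), and put $\overline T=(C\otimes_R\widehat T)\cap(\widehat T\otimes_S D)\subseteq\widehat T\otimes_S T\otimes_R\widehat T$. Let $h:\overline T\to\widehat T$, $h(\hat x\otimes y\otimes\hat y)=\mathrm{ev}(\hat x\otimes y)\hat y$, and $\chi:T\otimes_R\overline T\otimes_S T\to T$, $\chi(x\otimes\hat x\otimes y\otimes\hat y\otimes z)=\widehat{\mathrm{ev}}(x\otimes\hat x)\,y\,\mathrm{ev}(\hat y\otimes z)$ (finite sums of simple tensors are understood). **Theorem.** Let $(T,\gamma)$ be a tame $B$-$A$ herd. There are unique additive maps $\varepsilon_C:C\to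 R$, $\varepsilon_D:D\to S$, $\mathrm{cov}:C\to\overline T\otimes_S T$, $\overline{\mathrm{cov}}:D\to T\otimes_R\overline T$ such that $\alpha\varepsilon_C=\mathrm{ev}|_C$, $\beta\varepsilon_D=\widehat{\mathrm{ev}}|_D$, and such that $\mathrm{cov}$, $\overline{\mathrm{cov}}$ become $(\widehat T\otimes\gamma)|_C$, $(\gamma\otimes\widehat T)|_D$ under the canonical maps $\overline T\otimes_S T\to\widehat T\otimes_S T\otimes_R\widehat T\otimes_S T$, $T\otimes_R\overline T\to T\otimes_R\widehat T\otimes_S T\otimes_R\widehat T$. The products $\overline T\otimes_S\chi$ on $\overline T\otimes_S T$ and $\chi\otimes_R\overline T$ on $T\otimes_R\overline T$ descend to (possibly non-unital) ring structures on the coequalisers $$A'=\mathrm{coeq}\big((\overline T\otimes\chi)(\mathrm{cov}\otimes\overline T\otimes T),\ \varepsilon_C\otimes\overline T\otimes T:\ C\otimes_R\overline T\otimes_S T\rightrightarrows\overline T\otimes_S T\big),$$ $$B'=\mathrm{coeq}\big((\chi\otimes\overline T)(T\otimes\overline T\otimes\overline{\mathrm{cov}}),\ T\otimes\overline T\otimes\varepsilon_D:\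 T\otimes_R\overline T\otimes_S D\rightrightarrows T\otimes_R\overline T\big),$$ and the following hold. 1. There are ring morphisms $\nu_A:A'\to A$ and $\nu_B:B'\to B$ given by $\nu_A[\hat x\otimes x\otimes\hat y\otimes y]=\mathrm{ev}(\hat x\otimes x)\,\mathrm{ev}(\hat y\otimes y)$ and $\nu_B[x\otimes\hat x\otimes y\otimes\hat y]=\widehat{\mathrm{ev}}(x\otimes\hat x)\,\widehat{\mathrm{ev}}(y\otimes\hat y)$. 2. If $h:\overline T\to\widehat T$ is bijective, then $\nu_A$ and $\nu_B$ are isomorphisms; in particular $A'$ and $B'$ are unital rings. 3. If $\widehat T$ is flat as a left $R$-module and as a right $S$-module and $\overline T=\widehat T\otimes_S D=C\otimes_R\widehat T$ (as subgroups of $\widehat T\otimes_S T\otimes_R\widehat T$), then $\nu_A$ and $\nu_B$ are isomorphisms of rings. -/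

import Mathlib

open MulOpposite

universe u v

/-! ## Tensor products over noncommutative rings

Right `R`-modules are modules over `Rᵐᵒᵖ`, so `op r • m` is `m r`. -/

section BalancedTensor

variable (R : Type*) [Ring R]

/-- The relations `m r ⊗ n - m ⊗ r n` in the tensor product over `ℤ`. -/
def balancedRel (M N : Type*) [AddCommGroup M] [AddCommGroup N] [Module Rᵐᵒᵖ M] [Module R N] :
    AddSubgroup (TensorProduct ℤ M N) :=
  AddSubgroup.closure
    {z | ∃ (m : M) (r : R) (n : N),
      z = TensorProduct.tmul ℤ (op r • m) n - TensorProduct.tmul ℤ m (r • n)}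

/-- The tensor product `M ⊗_R N` of a right `R`-module and a left `R`-module. -/
def BT (M N : Type*) [AddCommGroup M] [AddCommGroup N] [Module Rᵐᵒᵖ M] [Module R N] : Type _ :=
  TensorProduct ℤ M N ⧸ balancedRel R M N

namespace BT

variable {M M' N N' P : Type*} [AddCommGroup M] [AddCommGroup M'] [AddCommGroup N]
  [AddCommGroup N'] [AddCommGroup P] [Module Rᵐᵒᵖ M] [Module Rᵐᵒᵖ M'] [Module R N] [Module R N']

noncomputable instance : AddCommGroup (BT R M N) :=
  inferInstanceAs (AddCommGroup (TensorProduct ℤ M N ⧸ balancedRel R M N))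

/-- The pure tensor `m ⊗ n`. -/
noncomputable def tmul (m : M) (n : N) : BT R M N :=
  QuotientAddGroup.mk' (balancedRel R M N) (TensorProduct.tmul ℤ m n)

theorem add_tmul (m₁ m₂ : M) (n : N) : tmul R (m₁ + m₂) n = tmul R m₁ n + tmul R m₂ n := by
  simp only [tmul, TensorProduct.add_tmul, map_add]; rfl

theorem tmul_add (m : M) (n₁ n₂ : N) : tmul R m (n₁ + n₂) = tmul R m n₁ + tmul R m n₂ := by
  simp only [tmul, TensorProduct.tmul_add, map_add]; rfl

theorem zero_tmul (n : N) : tmul R (0 : M) n = 0 := by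
  simpa using add_tmul R (0 : M) 0 n

theorem tmul_zero (m : M) : tmul R m (0 : N) = 0 := by
  simpa using tmul_add R m (0 : N) 0

theorem tmul_balanced (m : M) (r : R) (n : N) : tmul R (op r • m) n = tmul R m (r • n) := by
  unfold tmul
  exact QuotientAddGroup.eq_iff_sub_mem.2 (AddSubgroup.subset_closure ⟨m, r, n, rfl⟩)

variable {R}

/-- The universal property: a balanced biadditive map induces a map on `M ⊗_R N`. -/
noncomputable def lift (f : M → N → P)
    (h₁ : ∀ m₁ m₂ n, f (m₁ + m₂) n = f m₁ n + f m₂ n)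
    (h₂ : ∀ m n₁ n₂, f m (n₁ + n₂) = f m n₁ + f m n₂)
    (h₃ : ∀ m (r : R) n, f (op r • m) n = f m (r • n)) : BT R M N →+ P :=
  QuotientAddGroup.lift (balancedRel R M N)
    (TensorProduct.liftAddHom
      (AddMonoidHom.mk' (fun m => AddMonoidHom.mk' (f m) (h₂ m))
        (fun m₁ m₂ => AddMonoidHom.ext fun n => h₁ m₁ m₂ n))
      (fun k m n => by
        have e₁ := map_zsmul (AddMonoidHom.mk' (fun m => AddMonoidHom.mk' (f m) (h₂ m))
          (fun m₁ m₂ => AddMonoidHom.ext fun n => h₁ m₁ m₂ n)) k m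
        have e₂ := map_zsmul (AddMonoidHom.mk' (f m) (h₂ m)) k n
        rw [e₁]
        exact e₂.symm))
    (by
      refine (AddSubgroup.closure_le _).2 ?_
      rintro _ ⟨m, r, n, rfl⟩
      simp [h₃])

@[simp] theorem lift_tmul (f : M → N → P) (h₁ h₂ h₃) (m : M) (n : N) :
    lift (R := R) f h₁ h₂ h₃ (tmul R m n) = f m n := rfl

theorem induction {p : BT R M N → Prop} (h₀ : p 0) (h : ∀ m n, p (tmul R m n))
    (ha : ∀ x y, p x → p y → p (x + y)) (z : BT R M N) : p z := by
  obtain ⟨z, rfl⟩ := QuotientAddGroup.mk'_surjective (balancedRel R M N) z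
  induction z using TensorProduct.induction_on with
  | zero => exact h₀
  | tmul m n => exact h m n
  | add x y hx hy => rw [map_add]; exact ha _ _ hx hy

theorem hom_ext {f g : BT R M N →+ P} (h : ∀ m n, f (tmul R m n) = g (tmul R m n)) : f = g := by
  ext z
  induction z using induction with
  | h₀ => simp
  | h m n => exact h m n
  | ha x y hx hy => simp [hx, hy]

theorem hom_congr {f g : BT R M N →+ P} (h : ∀ m n, f (tmul R m n) = g (tmul R m n))
    (z : BT R M N) : f z = g z := DFunLike.congr_fun (hom_ext h) z

/-- `f ⊗ g` for a right linear map `f` and a left linear map `g`. -/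
noncomputable def map (f : M →ₗ[Rᵐᵒᵖ] M') (g : N →ₗ[R] N') : BT R M N →+ BT R M' N' :=
  lift (fun m n => tmul R (f m) (g n)) (fun _ _ _ => by rw [map_add, add_tmul])
    (fun _ _ _ => by rw [map_add, tmul_add])
    (fun _ _ _ => by rw [map_smul, map_smul, tmul_balanced])

@[simp] theorem map_tmul (f : M →ₗ[Rᵐᵒᵖ] M') (g : N →ₗ[R] N') (m : M) (n : N) :
    map f g (tmul R m n) = tmul R (f m) (g n) := rfl

section Actions

variable {K L : Type*} [Ring K] [Ring L]

/-- Left multiplication by `k` on the left factor. -/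
noncomputable def leftAct [Module K M] [SMulCommClass K Rᵐᵒᵖ M] (k : K) : BT R M N →+ BT R M N :=
  lift (fun m n => tmul R (k • m) n) (fun _ _ _ => by rw [smul_add, add_tmul])
    (fun _ _ _ => by rw [tmul_add]) (fun _ _ _ => by rw [smul_comm, tmul_balanced])

/-- Right multiplication by `l` on the right factor. -/
noncomputable def rightAct [Module Lᵐᵒᵖ N] [SMulCommClass R Lᵐᵒᵖ N] (l : Lᵐᵒᵖ) :
    BT R M N →+ BT R M N :=
  lift (fun m n => tmul R m (l • n)) (fun _ _ _ => by rw [add_tmul])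
    (fun _ _ _ => by rw [smul_add, tmul_add])
    (fun _ _ _ => by rw [tmul_balanced, smul_comm])

/-- A left action on the left factor induces a left action on the tensor product. -/
noncomputable instance leftModule [Module K M] [SMulCommClass K Rᵐᵒᵖ M] : Module K (BT R M N) where
  smul k z := leftAct k z
  smul_zero k := map_zero (leftAct k)
  smul_add k := map_add (leftAct k)
  zero_smul z := hom_congr (f := leftAct (0 : K)) (g := 0)
    (fun m n => by simp [leftAct, zero_tmul]) z
  add_smul k l z := hom_congr (f := leftAct (k + l)) (g := leftAct k + leftAct l)
    (fun m n => by simp [leftAct, add_smul, add_tmul]) z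
  one_smul z := hom_congr (f := leftAct (1 : K)) (g := AddMonoidHom.id _)
    (fun m n => by simp [leftAct]) z
  mul_smul k l z := hom_congr (f := leftAct (k * l)) (g := (leftAct k).comp (leftAct l))
    (fun m n => by simp [leftAct, mul_smul]) z

/-- A right action on the right factor induces a right action on the tensor product. -/
noncomputable instance rightModule [Module Lᵐᵒᵖ N] [SMulCommClass R Lᵐᵒᵖ N] :
    Module Lᵐᵒᵖ (BT R M N) where
  smul k z := rightAct k z
  smul_zero k := map_zero (rightAct k)
  smul_add k := map_add (rightAct k)
  zero_smul z := hom_congr (f := rightAct (0 : Lᵐᵒᵖ)) (g := 0)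
    (fun m n => by simp [rightAct, tmul_zero]) z
  add_smul k l z := hom_congr (f := rightAct (k + l)) (g := rightAct k + rightAct l)
    (fun m n => by simp [rightAct, add_smul, tmul_add]) z
  one_smul z := hom_congr (f := rightAct (1 : Lᵐᵒᵖ)) (g := AddMonoidHom.id _)
    (fun m n => by simp [rightAct]) z
  mul_smul k l z := hom_congr (f := rightAct (k * l)) (g := (rightAct k).comp (rightAct l))
    (fun m n => by simp [rightAct, mul_smul]) z

theorem smul_tmul [Module K M] [SMulCommClass K Rᵐᵒᵖ M] (k : K) (m : M) (n : N) :
    k • tmul R m n = tmul R (k • m) n := rfl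

theorem op_smul_tmul [Module Lᵐᵒᵖ N] [SMulCommClass R Lᵐᵒᵖ N] (l : Lᵐᵒᵖ) (m : M) (n : N) :
    l • tmul R m n = tmul R m (l • n) := rfl

instance [Module K M] [SMulCommClass K Rᵐᵒᵖ M] [Module Lᵐᵒᵖ N] [SMulCommClass R Lᵐᵒᵖ N] :
    SMulCommClass K Lᵐᵒᵖ (BT R M N) where
  smul_comm k l z := by
    induction z using induction with
    | h₀ => simp
    | h m n => simp only [smul_tmul, op_smul_tmul]
    | ha x y hx hy => simp only [smul_add, hx, hy]

/-- `m ⊗ -` as a right linear map. -/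
noncomputable def mkL [Module Lᵐᵒᵖ N] [SMulCommClass R Lᵐᵒᵖ N] (m : M) :
    N →ₗ[Lᵐᵒᵖ] BT R M N where
  toFun n := tmul R m n
  map_add' := tmul_add R m
  map_smul' _ _ := rfl

/-- `- ⊗ n` as a left linear map. -/
noncomputable def mkR [Module K M] [SMulCommClass K Rᵐᵒᵖ M] (n : N) : M →ₗ[K] BT R M N where
  toFun m := tmul R m n
  map_add' m₁ m₂ := add_tmul R m₁ m₂ n
  map_smul' _ _ := rfl

/-- `f ⊗ N` as a right linear map. -/
noncomputable def mapL [Module Lᵐᵒᵖ N] [SMulCommClass R Lᵐᵒᵖ N] (f : M →ₗ[Rᵐᵒᵖ] M') :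
    BT R M N →ₗ[Lᵐᵒᵖ] BT R M' N where
  toFun := map f LinearMap.id
  map_add' := map_add _
  map_smul' l z := by
    induction z using induction with
    | h₀ => simp
    | h m n => rfl
    | ha x y hx hy => simp only [smul_add, map_add, hx, hy]

@[simp] theorem mkL_apply [Module Lᵐᵒᵖ N] [SMulCommClass R Lᵐᵒᵖ N] (m : M) (n : N) :
    mkL (R := R) (L := L) m n = tmul R m n := rfl

@[simp] theorem mkR_apply [Module K M] [SMulCommClass K Rᵐᵒᵖ M] (m : M) (n : N) :
    mkR (R := R) (K := K) n m = tmul R m n := rfl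

@[simp] theorem mapL_tmul [Module Lᵐᵒᵖ N] [SMulCommClass R Lᵐᵒᵖ N] (f : M →ₗ[Rᵐᵒᵖ] M')
    (m : M) (n : N) : mapL (L := L) f (tmul R m n) = tmul R (f m) n := rfl

end Actions

section Assoc

variable {S : Type*} [Ring S] {Q : Type*} [AddCommGroup Q] [Module S Q]
  [Module Sᵐᵒᵖ N] [SMulCommClass R Sᵐᵒᵖ N]

/-- The associativity map `(M ⊗_R N) ⊗_S Q → M ⊗_R (N ⊗_S Q)`. -/
noncomputable def assoc : BT S (BT R M N) Q →+ BT R M (BT S N Q) :=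
  lift (fun v q => map (R := R) LinearMap.id (mkR (R := S) (K := R) (M := N) q) v)
    (fun _ _ _ => map_add _ _ _)
    (fun v q₁ q₂ => by
      induction v using induction with
      | h₀ => simp
      | h m n => simp [tmul_add]
      | ha x y hx hy => simp only [map_add, hx, hy]; abel)
    (fun v s q => by
      induction v using induction with
      | h₀ => simp
      | h m n => simp [op_smul_tmul, tmul_balanced]
      | ha x y hx hy => simp only [smul_add, map_add, hx, hy])

@[simp] theorem assoc_tmul (m : M) (n : N) (q : Q) :
    assoc (tmul S (tmul R m n) q) = tmul R m (tmul S n q) := rfl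

end Assoc

end BT

/-- Flatness of a right module: `M ⊗_R -` preserves injections. -/
def FlatRight (R M : Type u) [Ring R] [AddCommGroup M] [Module Rᵐᵒᵖ M] : Prop :=
  ∀ (N N' : Type u) [AddCommGroup N] [AddCommGroup N'] [Module R N] [Module R N']
    (g : N →ₗ[R] N'), Function.Injective g →
      Function.Injective (BT.map (LinearMap.id : M →ₗ[Rᵐᵒᵖ] M) g)

/-- Flatness of a left module: `- ⊗_R N` preserves injections. -/
def FlatLeft (R N : Type u) [Ring R] [AddCommGroup N] [Module R N] : Prop :=
  ∀ (M M' : Type u) [AddCommGroup M] [AddCommGroup M'] [Module Rᵐᵒᵖ M] [Module Rᵐᵒᵖ M']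
    (f : M →ₗ[Rᵐᵒᵖ] M'), Function.Injective f →
      Function.Injective (BT.map f (LinearMap.id : N →ₗ[R] N))

/-- Faithful flatness of a right module: flat, and `M ⊗_R N = 0` only for `N = 0`. -/
def FaithfullyFlatRight (R M : Type u) [Ring R] [AddCommGroup M] [Module Rᵐᵒᵖ M] : Prop :=
  FlatRight R M ∧ ∀ (N : Type u) [AddCommGroup N] [Module R N],
    Subsingleton (BT R M N) → Subsingleton N

/-- Faithful flatness of a left module: flat, and `M ⊗_R N = 0` only for `M = 0`. -/
def FaithfullyFlatLeft (R N : Type u) [Ring R] [AddCommGroup N] [Module R N] : Prop :=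
  FlatLeft R N ∧ ∀ (M : Type u) [AddCommGroup M] [Module Rᵐᵒᵖ M],
    Subsingleton (BT R M N) → Subsingleton M

end BalancedTensor

/-! ## Restriction of scalars for bimodules -/

section Restriction

variable {K L K' L' : Type*} [Ring K] [Ring L] [Ring K'] [Ring L']

/-- An `L`-`L'` bimodule `M`, which is also a `K`-`K'` bimodule through the ring maps
`lam : K → L` and `rho : K' → L'`. -/
def Res (_lam : K →+* L) (_rho : K' →+* L') (M : Type*) : Type _ := M

namespace Res

variable (lam : K →+* L) (rho : K' →+* L') (M : Type*) [AddCommGroup M]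

instance : AddCommGroup (Res lam rho M) := inferInstanceAs (AddCommGroup M)

/-- The identity map `M → Res lam rho M`. -/
def of : M ≃+ Res lam rho M := AddEquiv.refl M

instance bigLeft [Module L M] : Module L (Res lam rho M) := inferInstanceAs (Module L M)

instance bigRight [Module L'ᵐᵒᵖ M] : Module L'ᵐᵒᵖ (Res lam rho M) := inferInstanceAs (Module L'ᵐᵒᵖ M)

/-- The action `k • x = lam k • x`. -/
instance left [Module L M] : Module K (Res lam rho M) := Module.compHom M lam

/-- The action `x k = x (rho k)`. -/
instance right [Module L'ᵐᵒᵖ M] : Module K'ᵐᵒᵖ (Res lam rho M) := Module.compHom M rho.op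

variable {lam rho M}

theorem left_smul [Module L M] (k : K) (x : Res lam rho M) : k • x = lam k • x := rfl

theorem right_smul [Module L'ᵐᵒᵖ M] (k : K') (x : Res lam rho M) : op k • x = op (rho k) • x := rfl

variable [Module L M] [Module L'ᵐᵒᵖ M] [SMulCommClass L L'ᵐᵒᵖ M]

instance commBigBig : SMulCommClass L L'ᵐᵒᵖ (Res lam rho M) :=
  inferInstanceAs (SMulCommClass L L'ᵐᵒᵖ M)

instance commBigRight : SMulCommClass L K'ᵐᵒᵖ (Res lam rho M) where
  smul_comm l k x := by
    obtain ⟨k, rfl⟩ := op_surjective k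
    simp only [right_smul, smul_comm]

instance commLeftBig : SMulCommClass K L'ᵐᵒᵖ (Res lam rho M) where
  smul_comm k l x := by simp only [left_smul, smul_comm]

instance comm : SMulCommClass K K'ᵐᵒᵖ (Res lam rho M) where
  smul_comm l k x := by
    obtain ⟨k, rfl⟩ := op_surjective k
    simp only [right_smul, left_smul, smul_comm]

end Res

end Restriction

/-! ## Formal duals and herds -/

section Herds

variable {R S A B : Type u} [Ring R] [Ring S] [Ring A] [Ring B] (α : R →+* A) (β : S →+* B)
  (T T' : Type u) [AddCommGroup T] [AddCommGroup T'] [Module B T] [Module Aᵐᵒᵖ T]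
  [SMulCommClass B Aᵐᵒᵖ T] [Module A T'] [Module Bᵐᵒᵖ T'] [SMulCommClass A Bᵐᵒᵖ T']

/-- `T'` as an `A`-`B` bimodule (hence `R`-`S` bimodule) is a formal dual of the `B`-`A` bimodule
(hence `S`-`R` bimodule) `T`. -/
structure FormalDual where
  /-- the `A`-bimodule map `ev : T' ⊗_S T → A` -/
  ev : BT S (Res α β T') (Res β α T) →+ A
  ev_left : ∀ (a : A) (y : Res α β T') (x : Res β α T),
    ev (BT.tmul S (a • y) x) = a * ev (BT.tmul S y x)
  ev_right : ∀ (a : A) (y : Res α β T') (x : Res β α T),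
    ev (BT.tmul S y (op a • x)) = ev (BT.tmul S y x) * a
  /-- the `B`-bimodule map `evHat : T ⊗_R T' → B` -/
  evHat : BT R (Res β α T) (Res α β T') →+ B
  evHat_left : ∀ (b : B) (x : Res β α T) (y : Res α β T'),
    evHat (BT.tmul R (b • x) y) = b * evHat (BT.tmul R x y)
  evHat_right : ∀ (b : B) (x : Res β α T) (y : Res α β T'),
    evHat (BT.tmul R x (op b • y)) = evHat (BT.tmul R x y) * b
  /-- compatibility on `T ⊗_R T' ⊗_S T`: `evHat (x ⊗ y) z = x ev (y ⊗ z)` -/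
  evHat_smul_eq : ∀ (x : Res β α T) (y : Res α β T') (z : Res β α T),
    evHat (BT.tmul R x y) • z = op (ev (BT.tmul S y z)) • x
  /-- compatibility on `T' ⊗_S T ⊗_R T'`: `y evHat (x ⊗ z) = ev (y ⊗ x) z` -/
  smul_evHat : ∀ (y : Res α β T') (x : Res β α T) (z : Res α β T'),
    op (evHat (BT.tmul R x z)) • y = ev (BT.tmul S y x) • z

namespace FormalDual

variable {α β T T'} (H : FormalDual α β T T')

theorem ev_smul (r : R) (w : BT S (Res α β T') (Res β α T)) : H.ev (r • w) = α r * H.ev w := by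
  induction w using BT.induction with
  | h₀ => rw [smul_zero, map_zero, mul_zero]
  | h x y => exact H.ev_left (α r) x y
  | ha v w hv hw => rw [smul_add, map_add, map_add, hv, hw, mul_add]

theorem ev_op_smul (r : R) (w : BT S (Res α β T') (Res β α T)) : H.ev (op r • w) = H.ev w * α r := by
  induction w using BT.induction with
  | h₀ => rw [smul_zero, map_zero, zero_mul]
  | h x y => exact H.ev_right (α r) x y
  | ha v w hv hw => rw [smul_add, map_add, map_add, hv, hw, add_mul]

theorem evHat_smul (s : S) (w : BT R (Res β α T) (Res α β T')) : H.evHat (s • w) = β s * H.evHat w := by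
  induction w using BT.induction with
  | h₀ => rw [smul_zero, map_zero, mul_zero]
  | h x y => exact H.evHat_left (β s) x y
  | ha v w hv hw => rw [smul_add, map_add, map_add, hv, hw, mul_add]

theorem evHat_op_smul (s : S) (w : BT R (Res β α T) (Res α β T')) : H.evHat (op s • w) = H.evHat w * β s := by
  induction w using BT.induction with
  | h₀ => rw [smul_zero, map_zero, zero_mul]
  | h x y => exact H.evHat_right (β s) x y
  | ha v w hv hw => rw [smul_add, map_add, map_add, hv, hw, add_mul]

/-- `ev` as a left `R`-linear map. -/
noncomputable def evLeft : BT S (Res α β T') (Res β α T) →ₗ[R] Res α α A where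
  toFun w := Res.of _ _ _ (H.ev w)
  map_add' v w := by rw [map_add, map_add]
  map_smul' r w := H.ev_smul r w

/-- `ev` as a right `R`-linear map. -/
noncomputable def evRight : BT S (Res α β T') (Res β α T) →ₗ[Rᵐᵒᵖ] Res α α A where
  toFun w := Res.of _ _ _ (H.ev w)
  map_add' v w := by rw [map_add, map_add]
  map_smul' r w := H.ev_op_smul r.unop w

/-- `evHat` as a left `S`-linear map. -/
noncomputable def evHatLeft : BT R (Res β α T) (Res α β T') →ₗ[S] Res β β B where
  toFun w := Res.of _ _ _ (H.evHat w)
  map_add' v w := by rw [map_add, map_add]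
  map_smul' r w := H.evHat_smul r w

/-- `evHat` as a right `S`-linear map. -/
noncomputable def evHatRight : BT R (Res β α T) (Res α β T') →ₗ[Sᵐᵒᵖ] Res β β B where
  toFun w := Res.of _ _ _ (H.evHat w)
  map_add' v w := by rw [map_add, map_add]
  map_smul' r w := H.evHat_op_smul r.unop w

end FormalDual

/-- `T' ⊗_S T`. -/
abbrev TW : Type u := BT S (Res α β T') (Res β α T)

/-- `T ⊗_R T'`. -/
abbrev TV : Type u := BT R (Res β α T) (Res α β T')

/-- `T ⊗_R T' ⊗_S T`. -/
abbrev TG : Type u := BT S (TV α β T T') (Res β α T)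

/-- `T' ⊗_S T ⊗_R T'`. -/
abbrev TX : Type u := BT R (TW α β T T') (Res α β T')

/-- `M ⊗_S T ⊗_R T' ⊗_S T` for a right `S`-module `M`. -/
abbrev TExt (M : Type u) [AddCommGroup M] [Module Sᵐᵒᵖ M] : Type u :=
  BT S (BT R (BT S M (Res β α T)) (Res α β T')) (Res β α T)

variable {α β T T'}

/-- For `m ∈ M`, the map `T ⊗ T' ⊗ T → M ⊗ T ⊗ T' ⊗ T`, `x ⊗ y ⊗ z ↦ m ⊗ x ⊗ y ⊗ z`. -/
noncomputable def insertG {M : Type u} [AddCommGroup M] [Module Sᵐᵒᵖ M] (m : M) :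
    TG α β T T' →+ TExt α β T T' M :=
  BT.map (BT.mapL (BT.mkL m)) LinearMap.id

/-- The associativity map `M ⊗_S (T ⊗_R T' ⊗_S T) → M ⊗_S T ⊗_R T' ⊗_S T`. -/
noncomputable def joinG (M : Type u) [AddCommGroup M] [Module Sᵐᵒᵖ M] :
    BT S M (TG α β T T') →+ TExt α β T T' M :=
  BT.lift (fun m g => insertG m g)
    (fun m₁ m₂ g => by
      refine BT.hom_congr (f := insertG (m₁ + m₂)) (g := insertG m₁ + insertG m₂) (fun v z => ?_) g
      induction v using BT.induction with
      | h₀ => simp only [BT.zero_tmul, map_zero]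
      | h x y => simp [insertG, BT.add_tmul]
      | ha v w hv hw => simp only [BT.add_tmul, map_add, hv, hw])
    (fun m => map_add _)
    (fun m s g => by
      induction g using BT.induction with
      | h₀ => simp only [smul_zero, map_zero]
      | h v z =>
        induction v using BT.induction with
        | h₀ => simp only [BT.zero_tmul, smul_zero, map_zero]
        | h x y => simp [insertG, BT.smul_tmul, BT.tmul_balanced]
        | ha v w hv hw => simp only [BT.add_tmul, smul_add, map_add, hv, hw]
      | ha v w hv hw => simp only [smul_add, map_add, hv, hw])

/-- `x ⊗ - : T' ⊗_S T ⊗_R T' → T ⊗_R T' ⊗_S T ⊗_R T'`. -/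
noncomputable def insertX (x : Res β α T) : TX α β T T' →+ BT R (TG α β T T') (Res α β T') :=
  BT.map (BT.mapL (BT.mkL x)) LinearMap.id

/-- The associativity map `T ⊗_R (T' ⊗_S T ⊗_R T') → T ⊗_R T' ⊗_S T ⊗_R T'`. -/
noncomputable def joinX :
    BT R (Res β α T) (TX α β T T') →+ BT R (TG α β T T') (Res α β T') :=
  BT.lift (fun x u => insertX x u)
    (fun m₁ m₂ g => by
      refine BT.hom_congr (f := insertX (m₁ + m₂)) (g := insertX m₁ + insertX m₂) (fun v z => ?_) g
      induction v using BT.induction with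
      | h₀ => simp only [BT.zero_tmul, map_zero]
      | h x y => simp [insertX, BT.add_tmul]
      | ha v w hv hw => simp only [BT.add_tmul, map_add, hv, hw])
    (fun m => map_add _)
    (fun m s g => by
      induction g using BT.induction with
      | h₀ => simp only [smul_zero, map_zero]
      | h v z =>
        induction v using BT.induction with
        | h₀ => simp only [BT.zero_tmul, smul_zero, map_zero]
        | h x y => simp [insertX, BT.smul_tmul, BT.tmul_balanced]
        | ha v w hv hw => simp only [BT.add_tmul, smul_add, map_add, hv, hw]
      | ha v w hv hw => simp only [smul_add, map_add, hv, hw])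

variable (α β T T')

/-- A `B`-`A` herd: a `B`-`A` bimodule `T` with a formal dual `T'` (the pen) and a shepherd
`γ : T → T ⊗_R T' ⊗_S T`. -/
structure Herd extends FormalDual α β T T' where
  /-- the shepherd, an `S`-`R` bimodule map -/
  γ : Res β α T →+ TG α β T T'
  γ_left : ∀ (s : S) (x : Res β α T), γ (s • x) = s • γ x
  γ_right : ∀ (r : R) (x : Res β α T), γ (op r • x) = op r • γ x
  /-- `(evHat ⊗ T) (γ x) = 1 ⊗ x` in `B ⊗_S T` -/
  counit_left : ∀ x : Res β α T,
    BT.map toFormalDual.evHatRight LinearMap.id (γ x) = BT.tmul S (Res.of β β B 1) x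
  /-- `(T ⊗ ev) (γ x) = x ⊗ 1` in `T ⊗_R A` -/
  counit_right : ∀ x : Res β α T,
    BT.map LinearMap.id toFormalDual.evLeft (BT.assoc (γ x)) = BT.tmul R x (Res.of α α A 1)
  /-- `(γ ⊗ T' ⊗ T) (γ x) = (T ⊗ T' ⊗ γ) (γ x)` -/
  coassoc : ∀ x : Res β α T,
    BT.map (BT.mapL { toFun := γ, map_add' := map_add γ, map_smul' := fun r x => γ_right r.unop x })
        LinearMap.id (γ x) =
      joinG (TV α β T T')
        (BT.map LinearMap.id { toFun := γ, map_add' := map_add γ, map_smul' := γ_left } (γ x))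

variable {α β T T'}

namespace Herd

variable (H : Herd α β T T')

/-- Tameness: `ev` and `evHat` are surjective, and `T` is faithfully flat as a right `R`-module and
as a left `S`-module. -/
def IsTame : Prop :=
  Function.Surjective H.ev ∧ Function.Surjective H.evHat ∧
    FaithfullyFlatRight R (Res β α T) ∧ FaithfullyFlatLeft S (Res β α T)

/-- The shepherd as a left `S`-linear map. -/
noncomputable def γLeft : Res β α T →ₗ[S] TG α β T T' :=
  { toFun := H.γ, map_add' := map_add H.γ, map_smul' := H.γ_left }

/-- The shepherd as a right `R`-linear map. -/
noncomputable def γRight : Res β α T →ₗ[Rᵐᵒᵖ] TG α β T T' :=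
  { toFun := H.γ, map_add' := map_add H.γ, map_smul' := fun r x => H.γ_right r.unop x }

/-- `T' ⊗ γ : T' ⊗_S T → T' ⊗_S T ⊗_R T' ⊗_S T`. -/
noncomputable def idγ : TW α β T T' →+ BT S (TX α β T T') (Res β α T) :=
  (joinG (Res α β T')).comp (BT.map LinearMap.id H.γLeft)

/-- `γ ⊗ T' : T ⊗_R T' → T ⊗_R T' ⊗_S T ⊗_R T'`. -/
noncomputable def γid : TV α β T T' →+ BT R (TG α β T T') (Res α β T') :=
  BT.map H.γRight LinearMap.id

/-! ### The bimodules `C` and `D` -/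

/-- `(ev ⊗ T' ⊗ T) ∘ (T' ⊗ γ) : T' ⊗_S T → A ⊗_R T' ⊗_S T`. -/
noncomputable def xiC : TW α β T T' →+ BT S (BT R (Res α α A) (Res α β T')) (Res β α T) :=
  (BT.map (BT.mapL H.evRight) LinearMap.id).comp H.idγ

variable (α β T T') in
/-- `α ⊗ T' ⊗ T : T' ⊗_S T → A ⊗_R T' ⊗_S T`, i.e. `w ↦ 1 ⊗ w`. -/
noncomputable def zetaC : TW α β T T' →+ BT S (BT R (Res α α A) (Res α β T')) (Res β α T) :=
  BT.map (BT.mkL (Res.of α α A 1)) LinearMap.id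

/-- `C ⊆ T' ⊗_S T`, the equaliser of `(ev ⊗ T' ⊗ T) ∘ (T' ⊗ γ)` and `α ⊗ T' ⊗ T`. -/
noncomputable def C : AddSubgroup (TW α β T T') := H.xiC.eqLocus (zetaC α β T T')

/-- `(T ⊗ T' ⊗ evHat) ∘ (γ ⊗ T') : T ⊗_R T' → T ⊗_R T' ⊗_S B`. -/
noncomputable def xiD : TV α β T T' →+ BT S (TV α β T T') (Res β β B) :=
  (BT.map LinearMap.id H.evHatLeft).comp (BT.assoc.comp H.γid)

variable (α β T T') in
/-- `T ⊗ T' ⊗ β : T ⊗_R T' → T ⊗_R T' ⊗_S B`, i.e. `v ↦ v ⊗ 1`. -/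
noncomputable def zetaD : TV α β T T' →+ BT S (TV α β T T') (Res β β B) :=
  (BT.mkR (R := S) (K := S) (M := TV α β T T') (Res.of β β B 1)).toAddMonoidHom

/-- `D ⊆ T ⊗_R T'`, the equaliser of `(T ⊗ T' ⊗ evHat) ∘ (γ ⊗ T')` and `T ⊗ T' ⊗ β`. -/
noncomputable def D : AddSubgroup (TV α β T T') := H.xiD.eqLocus (zetaD α β T T')


/-! ### The bimodule `Tbar` and the map `h` -/

/-- `y ⊗ - : T ⊗_R T' → T' ⊗_S T ⊗_R T'`. -/
noncomputable def insertV (y : Res α β T') : TV α β T T' →ₗ[Sᵐᵒᵖ] TX α β T T' :=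
  BT.mapL (BT.mkL y)

/-- `C ⊗_R T'` inside `T' ⊗_S T ⊗_R T'`, i.e. the image of the canonical map. -/
noncomputable def CT : AddSubgroup (TX α β T T') :=
  AddSubgroup.closure {u | ∃ c ∈ H.C, ∃ y : Res α β T', u = BT.tmul R c y}

/-- `T' ⊗_S D` inside `T' ⊗_S T ⊗_R T'`, i.e. the image of the canonical map. -/
noncomputable def TD : AddSubgroup (TX α β T T') :=
  AddSubgroup.closure {u | ∃ y : Res α β T', ∃ d ∈ H.D, u = insertV y d}

/-- `Tbar = (C ⊗_R T') ∩ (T' ⊗_S D)`. -/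
noncomputable def Tbar : AddSubgroup (TX α β T T') := H.CT ⊓ H.TD

theorem xiC_smul (r : R) (w : TW α β T T') : H.xiC (r • w) = r • H.xiC w := by
  induction w using BT.induction with
  | h₀ => simp only [smul_zero, map_zero]
  | ha v w hv hw => simp only [smul_add, map_add, hv, hw]
  | h y x =>
    have key : ∀ g : TG α β T T',
        BT.map (BT.mapL (L := S) H.evRight) LinearMap.id (insertG (r • y) g) =
          r • BT.map (BT.mapL (L := S) H.evRight) LinearMap.id (insertG y g) := by
      intro g
      induction g using BT.induction with
      | h₀ => simp only [smul_zero, map_zero]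
      | ha v w hv hw => simp only [smul_add, map_add, hv, hw]
      | h v z =>
        induction v using BT.induction with
        | h₀ => simp only [BT.zero_tmul, smul_zero, map_zero]
        | ha v w hv hw => simp only [BT.add_tmul, smul_add, map_add, hv, hw]
        | h x' y' =>
          have e := H.evLeft.map_smul r (BT.tmul S y x')
          simp only [insertG, BT.map_tmul, BT.mapL_tmul, BT.mkL_apply, BT.smul_tmul] at e ⊢
          exact congrArg (fun a => BT.tmul S (BT.tmul R a y') z) e
    exact key (H.γLeft x)

theorem zetaC_smul (r : R) (w : TW α β T T') :
    zetaC α β T T' (r • w) = r • zetaC α β T T' w := by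
  induction w using BT.induction with
  | h₀ => simp only [smul_zero, map_zero]
  | ha v w hv hw => simp only [smul_add, map_add, hv, hw]
  | h y x =>
    simp only [zetaC, BT.smul_tmul, BT.map_tmul, BT.mkL_apply]
    rw [← BT.tmul_balanced]
    congr 2
    change (1 : A) * α r = α r * 1
    rw [one_mul, mul_one]

theorem smul_mem_C (r : R) {w : TW α β T T'} (hw : w ∈ H.C) : r • w ∈ H.C := by
  change H.xiC _ = zetaC _ _ _ _ _
  rw [xiC_smul, zetaC_smul, show H.xiC w = zetaC α β T T' w from hw]

theorem xiD_smul (s : S) (v : TV α β T T') : H.xiD (op s • v) = op s • H.xiD v := by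
  induction v using BT.induction with
  | h₀ => simp only [smul_zero, map_zero]
  | ha v w hv hw => simp only [smul_add, map_add, hv, hw]
  | h x y =>
    have key : ∀ g : TG α β T T',
        BT.map LinearMap.id H.evHatLeft (BT.assoc (BT.tmul R g (op s • y))) =
          op s • BT.map (LinearMap.id : TV α β T T' →ₗ[Sᵐᵒᵖ] _) H.evHatLeft
            (BT.assoc (BT.tmul R g y)) := by
      intro g
      induction g using BT.induction with
      | h₀ => simp only [BT.zero_tmul, smul_zero, map_zero]
      | ha v w hv hw => simp only [BT.add_tmul, smul_add, map_add, hv, hw]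
      | h v z =>
        have e := H.evHatRight.map_smul (op s) (BT.tmul R z y)
        simp only [BT.assoc_tmul, BT.map_tmul, BT.op_smul_tmul, LinearMap.id_apply] at e ⊢
        exact congrArg (fun a => BT.tmul S v a) e
    exact key (H.γRight x)

theorem zetaD_smul (s : S) (v : TV α β T T') :
    zetaD α β T T' (op s • v) = op s • zetaD α β T T' v := by
  change BT.tmul S (op s • v) _ = BT.tmul S v _
  rw [BT.tmul_balanced]
  congr 1
  change β s * (1 : B) = 1 * β s
  rw [one_mul, mul_one]

theorem op_smul_mem_D (s : S) {v : TV α β T T'} (hv : v ∈ H.D) : op s • v ∈ H.D := by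
  change H.xiD _ = zetaD _ _ _ _ _
  rw [xiD_smul, zetaD_smul, show H.xiD v = zetaD α β T T' v from hv]

theorem closure_stable {M : Type*} [AddCommGroup M] (f : M →+ M) (s : Set M)
    (h : ∀ x ∈ s, f x ∈ AddSubgroup.closure s) {x : M} (hx : x ∈ AddSubgroup.closure s) :
    f x ∈ AddSubgroup.closure s := by
  have : AddSubgroup.closure s ≤ (AddSubgroup.closure s).comap f :=
    (AddSubgroup.closure_le _).2 h
  exact this hx

theorem smul_insertV (r : R) (y : Res α β T') (v : TV α β T T') :
    r • insertV y v = insertV (r • y) v := by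
  induction v using BT.induction with
  | h₀ => simp only [smul_zero, map_zero]
  | h x z => rfl
  | ha v w hv hw => simp only [smul_add, map_add, hv, hw]

theorem smul_mem_Tbar (r : R) {u : TX α β T T'} (hu : u ∈ H.Tbar) : r • u ∈ H.Tbar := by
  constructor
  · refine closure_stable (DistribSMul.toAddMonoidHom _ r) _ ?_ hu.1
    rintro _ ⟨c, hc, y, rfl⟩
    exact AddSubgroup.subset_closure ⟨r • c, H.smul_mem_C r hc, y, rfl⟩
  · refine closure_stable (DistribSMul.toAddMonoidHom _ r) _ ?_ hu.2
    rintro _ ⟨y, d, hd, rfl⟩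
    exact AddSubgroup.subset_closure ⟨r • y, d, hd, smul_insertV r y d⟩

theorem op_smul_mem_Tbar (s : Sᵐᵒᵖ) {u : TX α β T T'} (hu : u ∈ H.Tbar) : s • u ∈ H.Tbar := by
  constructor
  · refine closure_stable (DistribSMul.toAddMonoidHom _ s) _ ?_ hu.1
    rintro _ ⟨c, hc, y, rfl⟩
    exact AddSubgroup.subset_closure ⟨c, hc, s • y, rfl⟩
  · refine closure_stable (DistribSMul.toAddMonoidHom _ s) _ ?_ hu.2
    rintro _ ⟨y, d, hd, rfl⟩
    exact AddSubgroup.subset_closure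
      ⟨y, s • d, H.op_smul_mem_D s.unop hd, ((insertV y).map_smul s d).symm⟩

noncomputable instance : SMul R H.Tbar := ⟨fun r u => ⟨r • u.1, H.smul_mem_Tbar r u.2⟩⟩

noncomputable instance : SMul Sᵐᵒᵖ H.Tbar := ⟨fun s u => ⟨s • u.1, H.op_smul_mem_Tbar s u.2⟩⟩

/-- The left `R`-action on `Tbar`, restricted from `T' ⊗_S T ⊗_R T'`. -/
noncomputable instance leftTbar : Module R H.Tbar :=
  Function.Injective.module R H.Tbar.subtype Subtype.val_injective (fun _ _ => rfl)

/-- The right `S`-action on `Tbar`, restricted from `T' ⊗_S T ⊗_R T'`. -/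
noncomputable instance rightTbar : Module Sᵐᵒᵖ H.Tbar :=
  Function.Injective.module Sᵐᵒᵖ H.Tbar.subtype Subtype.val_injective (fun _ _ => rfl)

instance commTbar : SMulCommClass R Sᵐᵒᵖ H.Tbar where
  smul_comm r s u := Subtype.ext (smul_comm r s u.1)

/-- The map `ev ⊗ T' : T' ⊗_S T ⊗_R T' → T'`, `w ⊗ y ↦ ev w • y`. -/
noncomputable def evAct : TX α β T T' →+ Res α β T' :=
  BT.lift (fun w y => H.ev w • y) (fun _ _ _ => by rw [map_add, add_smul])
    (fun _ _ _ => smul_add _ _ _)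
    (fun w r y => by rw [H.ev_op_smul, mul_smul, Res.left_smul])

/-- `h : Tbar → T'`, the restriction of `ev ⊗ T'`. -/
noncomputable def h : H.Tbar →+ Res α β T' := H.evAct.comp H.Tbar.subtype

/-! ### The map `χ` -/

/-- For `x ∈ T`, the map `T' ⊗_S T → T`, `y ⊗ z ↦ evHat (x ⊗ y) • z`. -/
noncomputable def evHatAct (x : Res β α T) : TW α β T T' →+ Res β α T :=
  BT.lift (fun y z => H.evHat (BT.tmul R x y) • z)
    (fun _ _ _ => by rw [BT.tmul_add, map_add, add_smul])
    (fun _ _ _ => smul_add _ _ _)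
    (fun y s z => by
      rw [Res.right_smul, H.evHat_right, mul_smul, Res.left_smul])

theorem evHatAct_eq (x : Res β α T) (w : TW α β T T') : H.evHatAct x w = op (H.ev w) • x := by
  induction w using BT.induction with
  | h₀ => simp
  | h y z => exact H.evHat_smul_eq x y z
  | ha v w hv hw => rw [map_add, hv, hw, map_add, op_add, add_smul]

/-- `χ` on `T ⊗ (T' ⊗_S T ⊗_R T') ⊗ T`: for `x, z ∈ T`,
`χ (x ⊗ (y₁ ⊗ y ⊗ y₂) ⊗ z) = evHat (x ⊗ y₁) • y • ev (y₂ ⊗ z)`. -/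
noncomputable def chi (x z : Res β α T) : TX α β T T' →+ Res β α T :=
  BT.lift (fun w y => op (H.ev (BT.tmul S y z)) • H.evHatAct x w)
    (fun _ _ _ => by rw [map_add, smul_add])
    (fun _ _ _ => by rw [BT.add_tmul, map_add, op_add, add_smul])
    (fun w r y => by
      rw [Res.left_smul, H.ev_left, evHatAct_eq, evHatAct_eq, H.ev_op_smul, ← mul_smul,
        ← mul_smul, ← op_mul, ← op_mul, mul_assoc])

theorem chi_tmul (x z : Res β α T) (w : TW α β T T') (y : Res α β T') :
    H.chi x z (BT.tmul R w y) = op (H.ev w * H.ev (BT.tmul S y z)) • x := by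
  change op (H.ev (BT.tmul S y z)) • H.evHatAct x w = _
  rw [evHatAct_eq, op_mul, mul_smul]

theorem chi_add_left (x₁ x₂ z : Res β α T) (u : TX α β T T') :
    H.chi (x₁ + x₂) z u = H.chi x₁ z u + H.chi x₂ z u :=
  BT.hom_congr (f := H.chi (x₁ + x₂) z) (g := H.chi x₁ z + H.chi x₂ z)
    (fun w y => by simp only [AddMonoidHom.add_apply, chi_tmul, smul_add]) u

theorem chi_add_right (x z₁ z₂ : Res β α T) (u : TX α β T T') :
    H.chi x (z₁ + z₂) u = H.chi x z₁ u + H.chi x z₂ u :=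
  BT.hom_congr (f := H.chi x (z₁ + z₂)) (g := H.chi x z₁ + H.chi x z₂)
    (fun w y => by
      simp only [AddMonoidHom.add_apply, chi_tmul, BT.tmul_add, map_add, mul_add, op_add,
        add_smul]) u

theorem chi_smul (s : S) (x z : Res β α T) (u : TX α β T T') :
    H.chi (s • x) z u = s • H.chi x z u :=
  BT.hom_congr (f := H.chi (s • x) z) (g := (DistribSMul.toAddMonoidHom _ s).comp (H.chi x z))
    (fun w y => by
      simp only [AddMonoidHom.comp_apply, chi_tmul, DistribSMul.toAddMonoidHom_apply]
      exact (smul_comm s _ _).symm) u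

theorem chi_op_smul (r : R) (x z : Res β α T) (u : TX α β T T') :
    H.chi x (op r • z) u = op r • H.chi x z u :=
  BT.hom_congr (f := H.chi x (op r • z))
    (g := (DistribSMul.toAddMonoidHom _ (op r)).comp (H.chi x z))
    (fun w y => by
      simp only [AddMonoidHom.comp_apply, chi_tmul, DistribSMul.toAddMonoidHom_apply,
        Res.right_smul, H.ev_right]
      rw [← mul_smul, ← op_mul, mul_assoc]) u

theorem chi_balanced_left (r : R) (x z : Res β α T) (u : TX α β T T') :
    H.chi (op r • x) z u = H.chi x z (r • u) :=
  BT.hom_congr (f := H.chi (op r • x) z)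
    (g := (H.chi x z).comp (DistribSMul.toAddMonoidHom _ r))
    (fun w y => by
      simp only [AddMonoidHom.comp_apply, DistribSMul.toAddMonoidHom_apply, BT.smul_tmul,
        chi_tmul, Res.right_smul, H.ev_smul]
      rw [← mul_smul, ← op_mul, mul_assoc]) u

theorem chi_balanced_right (s : S) (x z : Res β α T) (u : TX α β T T') :
    H.chi x z (op s • u) = H.chi x (s • z) u :=
  BT.hom_congr (f := (H.chi x z).comp (DistribSMul.toAddMonoidHom _ (op s)))
    (g := H.chi x (s • z))
    (fun w y => by
      simp only [AddMonoidHom.comp_apply, DistribSMul.toAddMonoidHom_apply, BT.op_smul_tmul,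
        chi_tmul, BT.tmul_balanced]) u

/-- Right `A`-linearity of `χ` in the last argument. -/
theorem chi_big_smul (a : A) (x z : Res β α T) (u : TX α β T T') :
    H.chi x (op a • z) u = op a • H.chi x z u :=
  BT.hom_congr (f := H.chi x (op a • z))
    (g := (DistribSMul.toAddMonoidHom _ (op a)).comp (H.chi x z))
    (fun w y => by
      simp only [AddMonoidHom.comp_apply, chi_tmul, DistribSMul.toAddMonoidHom_apply,
        H.ev_right]
      rw [← mul_smul, ← op_mul, mul_assoc]) u

/-- Associativity of `χ`. -/
theorem chi_assoc (x y z : Res β α T) (u v : TX α β T T') :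
    H.chi (H.chi x y u) z v = H.chi x (H.chi y z v) u := by
  induction v using BT.induction with
  | h₀ =>
    have : H.chi x 0 u = 0 := by simpa using H.chi_add_right x 0 0 u
    rw [map_zero, map_zero, this]
  | ha v w hv hw => rw [map_add, map_add, hv, hw, chi_add_right]
  | h w y' => rw [chi_tmul, chi_tmul, chi_big_smul]

/-! ### The nonunital rings `Tbar ⊗_S T` and `T ⊗_R Tbar` -/

/-- `Tbar ⊗_S T`. -/
abbrev PA : Type u := BT S H.Tbar (Res β α T)

/-- `T ⊗_R Tbar`. -/
abbrev PB : Type u := BT R (Res β α T) H.Tbar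

/-- For `x ∈ T`, the map `χ (x ⊗ -) : Tbar ⊗_S T → T`. -/
noncomputable def chiA (x : Res β α T) : H.PA →+ Res β α T :=
  BT.lift (fun u z => H.chi x z u.1) (fun _ _ _ => map_add _ _ _)
    (fun _ _ _ => H.chi_add_right _ _ _ _) (fun u s z => H.chi_balanced_right s x z u.1)

/-- For `z ∈ T`, the map `χ (- ⊗ z) : T ⊗_R Tbar → T`. -/
noncomputable def chiB (z : Res β α T) : H.PB →+ Res β α T :=
  BT.lift (fun x u => H.chi x z u.1) (fun _ _ _ => H.chi_add_left _ _ _ _)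
    (fun _ _ _ => map_add _ _ _) (fun x r u => H.chi_balanced_left r x z u.1)

theorem chiA_add (x₁ x₂ : Res β α T) (q : H.PA) :
    H.chiA (x₁ + x₂) q = H.chiA x₁ q + H.chiA x₂ q :=
  BT.hom_congr (f := H.chiA (x₁ + x₂)) (g := H.chiA x₁ + H.chiA x₂)
    (fun u z => H.chi_add_left _ _ _ u.1) q

theorem chiA_smul (s : S) (x : Res β α T) (q : H.PA) : H.chiA (s • x) q = s • H.chiA x q :=
  BT.hom_congr (f := H.chiA (s • x)) (g := (DistribSMul.toAddMonoidHom _ s).comp (H.chiA x))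
    (fun u z => H.chi_smul s x z u.1) q

theorem chiA_op_smul (r : R) (x : Res β α T) (q : H.PA) :
    H.chiA (op r • x) q = H.chiA x (r • q) :=
  BT.hom_congr (f := H.chiA (op r • x)) (g := (H.chiA x).comp (DistribSMul.toAddMonoidHom _ r))
    (fun u z => H.chi_balanced_left r x z u.1) q

theorem chiB_add (z₁ z₂ : Res β α T) (p : H.PB) :
    H.chiB (z₁ + z₂) p = H.chiB z₁ p + H.chiB z₂ p :=
  BT.hom_congr (f := H.chiB (z₁ + z₂)) (g := H.chiB z₁ + H.chiB z₂)
    (fun x u => H.chi_add_right _ _ _ u.1) p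

theorem chiB_op_smul (r : R) (z : Res β α T) (p : H.PB) :
    H.chiB (op r • z) p = op r • H.chiB z p :=
  BT.hom_congr (f := H.chiB (op r • z))
    (g := (DistribSMul.toAddMonoidHom _ (op r)).comp (H.chiB z))
    (fun x u => H.chi_op_smul r x z u.1) p

theorem chiB_smul (s : S) (z : Res β α T) (p : H.PB) :
    H.chiB (s • z) p = H.chiB z (op s • p) :=
  BT.hom_congr (f := H.chiB (s • z))
    (g := (H.chiB z).comp (DistribSMul.toAddMonoidHom _ (op s)))
    (fun x u => (H.chi_balanced_right s x z u.1).symm) p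

/-- The map `p ↦ p q` on `Tbar ⊗_S T`: `(u ⊗ x) q = u ⊗ χ (x ⊗ q)`. -/
noncomputable def mulA (q : H.PA) : H.PA →+ H.PA :=
  BT.lift (fun u x => BT.tmul S u (H.chiA x q)) (fun _ _ _ => BT.add_tmul _ _ _ _)
    (fun _ _ _ => by rw [chiA_add, BT.tmul_add])
    (fun _ _ _ => by rw [chiA_smul, BT.tmul_balanced])

/-- The map `q ↦ p q` on `T ⊗_R Tbar`: `p (z ⊗ u) = χ (p ⊗ z) ⊗ u`. -/
noncomputable def mulB (p : H.PB) : H.PB →+ H.PB :=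
  BT.lift (fun z u => BT.tmul R (H.chiB z p) u)
    (fun _ _ _ => by rw [chiB_add, BT.add_tmul])
    (fun _ _ _ => BT.tmul_add _ _ _ _)
    (fun _ _ _ => by rw [chiB_op_smul, BT.tmul_balanced])

noncomputable instance : Mul H.PA := ⟨fun p q => H.mulA q p⟩

noncomputable instance : Mul H.PB := ⟨fun p q => H.mulB p q⟩

theorem PA_tmul_mul (u : H.Tbar) (x : Res β α T) (q : H.PA) :
    (BT.tmul S u x : H.PA) * q = BT.tmul S u (H.chiA x q) := rfl

theorem PB_mul_tmul (p : H.PB) (z : Res β α T) (u : H.Tbar) :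
    p * (BT.tmul R z u : H.PB) = BT.tmul R (H.chiB z p) u := rfl

theorem PA_add_mul (p p' q : H.PA) : (p + p') * q = p * q + p' * q := map_add (H.mulA q) p p'

theorem PB_mul_add (p q q' : H.PB) : p * (q + q') = p * q + p * q' := map_add (H.mulB p) q q'

theorem PA_mul_add (p q q' : H.PA) : p * (q + q') = p * q + p * q' :=
  BT.hom_congr (f := H.mulA (q + q')) (g := H.mulA q + H.mulA q')
    (fun u x => by
      change BT.tmul S u (H.chiA x (q + q')) = BT.tmul S u _ + BT.tmul S u _
      rw [map_add, BT.tmul_add]) p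

theorem PB_add_mul (p p' q : H.PB) : (p + p') * q = p * q + p' * q :=
  BT.hom_congr (f := H.mulB (p + p')) (g := H.mulB p + H.mulB p')
    (fun z u => by
      change BT.tmul R (H.chiB z (p + p')) u = BT.tmul R _ u + BT.tmul R _ u
      rw [map_add, BT.add_tmul]) q

theorem chiA_mul (x : Res β α T) (p q : H.PA) : H.chiA x (p * q) = H.chiA (H.chiA x p) q := by
  induction p using BT.induction with
  | h₀ =>
    have e₁ : (0 : H.PA) * q = 0 := map_zero (H.mulA q)
    have e₂ : H.chiA 0 q = 0 := by simpa using H.chiA_add 0 0 q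
    rw [e₁, map_zero, e₂]
  | ha p p' hp hp' => rw [PA_add_mul, map_add, map_add, hp, hp', chiA_add]
  | h u y =>
    rw [PA_tmul_mul]
    refine BT.hom_congr (f := (H.chiA x).comp ((BT.mkL (L := R) u).toAddMonoidHom.comp (H.chiA y)))
      (g := H.chiA (H.chi x y u.1)) (fun v z => ?_) q
    exact (H.chi_assoc x y z u.1 v.1).symm

theorem chiB_mul (z : Res β α T) (p q : H.PB) : H.chiB z (p * q) = H.chiB (H.chiB z q) p := by
  induction q using BT.induction with
  | h₀ =>
    have e₁ : p * (0 : H.PB) = 0 := map_zero (H.mulB p)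
    have e₂ : H.chiB 0 p = 0 := by simpa using H.chiB_add 0 0 p
    rw [e₁, map_zero, e₂]
  | ha p p' hp hp' => rw [PB_mul_add, map_add, map_add, hp, hp', chiB_add]
  | h y u =>
    rw [PB_mul_tmul]
    refine BT.hom_congr (f := (H.chiB z).comp ((BT.mkR (K := S) u).toAddMonoidHom.comp (H.chiB y)))
      (g := H.chiB (H.chi y z u.1)) (fun x v => ?_) p
    exact H.chi_assoc x y z v.1 u.1

/-- The product `Tbar ⊗ χ` on `Tbar ⊗_S T`. -/
noncomputable instance ringPA : NonUnitalRing H.PA where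
  zero_mul q := map_zero (H.mulA q)
  mul_zero p := by simpa using H.PA_mul_add p 0 0
  left_distrib := H.PA_mul_add
  right_distrib := H.PA_add_mul
  mul_assoc p q q' :=
    BT.hom_congr (f := (H.mulA q').comp (H.mulA q)) (g := H.mulA (q * q'))
      (fun u x => congrArg (BT.tmul S u) (H.chiA_mul x q q').symm) p

/-- The product `χ ⊗ Tbar` on `T ⊗_R Tbar`. -/
noncomputable instance ringPB : NonUnitalRing H.PB where
  zero_mul q := by simpa using H.PB_add_mul 0 0 q
  mul_zero p := map_zero (H.mulB p)
  left_distrib := H.PB_mul_add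
  right_distrib := H.PB_add_mul
  mul_assoc p q q' :=
    BT.hom_congr (f := H.mulB (p * q)) (g := (H.mulB p).comp (H.mulB q))
      (fun z u => congrArg (fun x => BT.tmul R x u) (H.chiB_mul z p q)) q'

/-! ### The structure maps of the associated coherd -/

/-- The inclusion of `Tbar`, as a left `R`-linear map. -/
noncomputable def inclLeft : H.Tbar →ₗ[R] TX α β T T' where
  toFun u := u.1
  map_add' _ _ := rfl
  map_smul' _ _ := rfl

/-- The inclusion of `Tbar`, as a right `S`-linear map. -/
noncomputable def inclRight : H.Tbar →ₗ[Sᵐᵒᵖ] TX α β T T' where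
  toFun u := u.1
  map_add' _ _ := rfl
  map_smul' _ _ := rfl

/-- The canonical map `Tbar ⊗_S T → T' ⊗_S T ⊗_R T' ⊗_S T`. -/
noncomputable def iotaA : H.PA →+ BT S (TX α β T T') (Res β α T) :=
  BT.map H.inclRight LinearMap.id

/-- The canonical map `T ⊗_R Tbar → T ⊗_R T' ⊗_S T ⊗_R T'`. -/
noncomputable def iotaB : H.PB →+ BT R (TG α β T T') (Res α β T') :=
  joinX.comp (BT.map LinearMap.id H.inclLeft)

/-- `T ⊗ ev` followed by the action: `(x ⊗ y) ⊗ z ↦ x ev (y ⊗ z)`. -/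
noncomputable def actA : BT R (Res β α T) (Res α α A) →+ Res β α T :=
  BT.lift (fun x a => op ((Res.of α α A).symm a) • x) (fun _ _ _ => smul_add _ _ _)
    (fun _ _ _ => by rw [map_add, op_add, add_smul])
    (fun x r a => by
      rw [Res.right_smul, ← mul_smul, ← op_mul]
      rfl)

/-- `evHat ⊗ T` followed by the action: `v ⊗ z ↦ evHat v • z`. -/
noncomputable def actB : BT S (Res β β B) (Res β α T) →+ Res β α T :=
  BT.lift (fun b x => (Res.of β β B).symm b • x) (fun _ _ _ => by rw [map_add, add_smul])
    (fun _ _ _ => smul_add _ _ _)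
    (fun b s x => by
      rw [Res.left_smul, ← mul_smul]
      rfl)

/-- `χ (x ⊗ -)` on `T' ⊗_S T ⊗_R T' ⊗_S T`. -/
noncomputable def chiTX (x : Res β α T) : BT S (TX α β T T') (Res β α T) →+ Res β α T :=
  BT.lift (fun u z => H.chi x z u) (fun _ _ _ => map_add _ _ _)
    (fun _ _ _ => H.chi_add_right _ _ _ _) (fun u s z => H.chi_balanced_right s x z u)

theorem chiA_eq (x : Res β α T) (p : H.PA) : H.chiA x p = H.chiTX x (H.iotaA p) :=
  BT.hom_congr (f := H.chiA x) (g := (H.chiTX x).comp H.iotaA) (fun _ _ => rfl) p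

theorem chiTX_idγ (x : Res β α T) (w : TW α β T T') :
    H.chiTX x (H.idγ w) = op (H.ev w) • x := by
  induction w using BT.induction with
  | h₀ => simp
  | ha v w hv hw => rw [map_add, map_add, hv, hw, map_add, op_add, add_smul]
  | h y z =>
    have key : ∀ g : TG α β T T', H.chiTX x (insertG y g) =
        op (H.ev (BT.tmul S y
          (actA (BT.map LinearMap.id H.evLeft (BT.assoc g))))) • x := by
      intro g
      induction g using BT.induction with
      | h₀ => simp [BT.tmul_zero]
      | ha v w hv hw =>
        simp only [map_add, hv, hw, BT.tmul_add, op_add, add_smul]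
      | h v z =>
        induction v using BT.induction with
        | h₀ => simp [BT.tmul_zero, BT.zero_tmul]
        | ha v w hv hw =>
          simp only [map_add, hv, hw, BT.tmul_add, BT.add_tmul, op_add, add_smul]
        | h x' y' =>
          refine (H.chi_tmul x z (BT.tmul S y x') y').trans ?_
          exact congrArg (fun a => op a • x) (H.ev_right (H.ev (BT.tmul S y' z)) y x').symm
    refine (key (H.γ z)).trans ?_
    rw [H.counit_right]
    have : actA (BT.tmul R z (Res.of α α A 1)) = z := one_smul _ _
    rw [this]

/-- `χ (- ⊗ z)` on `T ⊗_R T' ⊗_S T ⊗_R T'`. -/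
noncomputable def chiTG (z : Res β α T) : BT R (TG α β T T') (Res α β T') →+ Res β α T :=
  BT.lift
    (fun g y => H.evHat (BT.tmul R (actB (BT.map H.evHatRight LinearMap.id g)) y) • z)
    (fun _ _ _ => by simp only [map_add, BT.add_tmul, add_smul])
    (fun _ _ _ => by simp only [map_add, BT.tmul_add, add_smul])
    (fun g r y => by
      rw [← BT.tmul_balanced]
      congr 3
      induction g using BT.induction with
      | h₀ => simp only [smul_zero, map_zero]
      | ha v w hv hw => simp only [smul_add, map_add, hv, hw]
      | h v x => exact smul_comm (H.evHat v) (op (α r)) x)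

theorem chiB_eq (z : Res β α T) (p : H.PB) : H.chiB z p = H.chiTG z (H.iotaB p) :=
  BT.hom_congr (f := H.chiB z) (g := (H.chiTG z).comp H.iotaB) (fun x u => by
    refine BT.hom_congr (f := H.chi x z) (g := (H.chiTG z).comp (insertX x)) (fun w y' => ?_) u.1
    rw [chi_tmul]
    induction w using BT.induction with
    | h₀ => simp [BT.zero_tmul]
    | ha v w hv hw =>
      rw [map_add, add_mul, op_add, add_smul, hv, hw, BT.add_tmul, map_add]
    | h y x' =>
      change _ = H.evHat (BT.tmul R (H.evHat (BT.tmul R x y) • x') y') • z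
      rw [H.evHat_smul_eq, H.evHat_smul_eq, op_mul, mul_smul]) p

theorem chiTG_γid (z : Res β α T) (v : TV α β T T') : H.chiTG z (H.γid v) = H.evHat v • z := by
  induction v using BT.induction with
  | h₀ => simp
  | ha v w hv hw => rw [map_add, map_add, hv, hw, map_add, add_smul]
  | h x y =>
    change H.evHat (BT.tmul R (actB (BT.map H.evHatRight LinearMap.id (H.γ x))) y) • z = _
    rw [H.counit_left]
    have : actB (BT.tmul S (Res.of β β B 1) x) = x := one_smul _ _
    rw [this]

/-- The counits `εC = ev|_C : C → R` and `εD = evHat|_D : D → S` and the maps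
`cov = Δ_C : C → Tbar ⊗_S T` and `covBar = Δ_D : D → T ⊗_R Tbar`, where `Δ_C` and `Δ_D` are the
restrictions of `T' ⊗ γ` and `γ ⊗ T'`. -/
structure CoherdMaps where
  εC : H.C →+ R
  εD : H.D →+ S
  cov : H.C →+ H.PA
  covBar : H.D →+ H.PB
  εC_eq : ∀ c : H.C, α (εC c) = H.ev c.1
  εD_eq : ∀ d : H.D, β (εD d) = H.evHat d.1
  cov_eq : ∀ c : H.C, H.iotaA (cov c) = H.idγ c.1
  covBar_eq : ∀ d : H.D, H.iotaB (covBar d) = H.γid d.1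

namespace CoherdMaps

variable {H} (d : H.CoherdMaps)

/-- The image in `Tbar ⊗_S T` of `ω = (Tbar ⊗ χ) ∘ (cov ⊗ Tbar ⊗ T) - εC ⊗ Tbar ⊗ T`, which is
spanned by the elements `ω (c ⊗ p) = cov c * p - εC c • p`. -/
noncomputable def imA : AddSubgroup H.PA :=
  AddSubgroup.closure {q | ∃ (c : H.C) (p : H.PA), q = d.cov c * p - d.εC c • p}

/-- The image in `T ⊗_R Tbar` of `(χ ⊗ Tbar) ∘ (T ⊗ Tbar ⊗ covBar) - T ⊗ Tbar ⊗ εD`, which is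
spanned by the elements `p * covBar c - p εD c`. -/
noncomputable def imB : AddSubgroup H.PB :=
  AddSubgroup.closure {q | ∃ (c : H.D) (p : H.PB), q = p * d.covBar c - op (d.εD c) • p}

theorem PA_smul_mul (r : R) (p q : H.PA) : (r • p) * q = r • (p * q) :=
  BT.hom_congr (f := (H.mulA q).comp (DistribSMul.toAddMonoidHom _ r))
    (g := (DistribSMul.toAddMonoidHom _ r).comp (H.mulA q)) (fun _ _ => rfl) p

theorem PB_mul_op_smul (s : S) (p q : H.PB) : p * (op s • q) = op s • (p * q) :=
  BT.hom_congr (f := (H.mulB p).comp (DistribSMul.toAddMonoidHom _ (op s)))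
    (g := (DistribSMul.toAddMonoidHom _ (op s)).comp (H.mulB p)) (fun _ _ => rfl) q

theorem mul_cov_mul (q p : H.PA) (c : H.C) : q * (d.cov c * p) = q * (d.εC c • p) :=
  BT.hom_congr (f := H.mulA (d.cov c * p)) (g := H.mulA (d.εC c • p)) (fun u x => by
    change BT.tmul S u (H.chiA x (d.cov c * p)) = BT.tmul S u (H.chiA x (d.εC c • p))
    rw [H.chiA_mul, H.chiA_eq x (d.cov c), d.cov_eq, H.chiTX_idγ, ← d.εC_eq, ← Res.right_smul,
      H.chiA_op_smul]) q

theorem mul_covBar_mul (q p : H.PB) (c : H.D) : p * d.covBar c * q = (op (d.εD c) • p) * q :=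
  BT.hom_congr (f := H.mulB (p * d.covBar c)) (g := H.mulB (op (d.εD c) • p)) (fun z u => by
    change BT.tmul R (H.chiB z (p * d.covBar c)) u = BT.tmul R (H.chiB z (op (d.εD c) • p)) u
    rw [H.chiB_mul, H.chiB_eq z (d.covBar c), d.covBar_eq, H.chiTG_γid, ← d.εD_eq,
      ← Res.left_smul, H.chiB_smul]) q

/-- The image of `ω` is a two-sided ideal of `Tbar ⊗_S T`. -/
noncomputable def idealA : TwoSidedIdeal H.PA :=
  TwoSidedIdeal.mk' d.imA (zero_mem d.imA) (fun h₁ h₂ => add_mem h₁ h₂) (fun h => neg_mem h)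
    (fun {x y} hy => by
      refine closure_stable (AddMonoidHom.mulLeft x) _ ?_ hy
      rintro _ ⟨c, p, rfl⟩
      have : x * (d.cov c * p - d.εC c • p) = 0 := by rw [mul_sub, d.mul_cov_mul, sub_self]
      rw [AddMonoidHom.coe_mulLeft, this]
      exact zero_mem _)
    (fun {x y} hx => by
      refine closure_stable (AddMonoidHom.mulRight y) _ ?_ hx
      rintro _ ⟨c, p, rfl⟩
      refine AddSubgroup.subset_closure ⟨c, p * y, ?_⟩
      rw [AddMonoidHom.mulRight_apply, sub_mul, mul_assoc, PA_smul_mul])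

/-- The corresponding two-sided ideal of `T ⊗_R Tbar`. -/
noncomputable def idealB : TwoSidedIdeal H.PB :=
  TwoSidedIdeal.mk' d.imB (zero_mem d.imB) (fun h₁ h₂ => add_mem h₁ h₂) (fun h => neg_mem h)
    (fun {x y} hy => by
      refine closure_stable (AddMonoidHom.mulLeft x) _ ?_ hy
      rintro _ ⟨c, p, rfl⟩
      refine AddSubgroup.subset_closure ⟨c, x * p, ?_⟩
      rw [AddMonoidHom.coe_mulLeft, mul_sub, mul_assoc, PB_mul_op_smul])
    (fun {x y} hx => by
      refine closure_stable (AddMonoidHom.mulRight y) _ ?_ hx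
      rintro _ ⟨c, p, rfl⟩
      have : (p * d.covBar c - op (d.εD c) • p) * y = 0 := by
        rw [sub_mul, d.mul_covBar_mul, sub_self]
      rw [AddMonoidHom.mulRight_apply, this]
      exact zero_mem _)

/-- The nonunital ring `A'`: the coequaliser `(Tbar ⊗_S T) / im ω`. -/
abbrev A' : Type u := d.idealA.ringCon.Quotient

/-- The nonunital ring `B'`: the coequaliser `(T ⊗_R Tbar) / im`. -/
abbrev B' : Type u := d.idealB.ringCon.Quotient

/-- The projection `Tbar ⊗_S T → A'`. -/
noncomputable def piA : H.PA →ₙ+* d.A' where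
  toFun p := p
  map_mul' _ _ := rfl
  map_zero' := rfl
  map_add' _ _ := rfl

/-- The projection `T ⊗_R Tbar → B'`. -/
noncomputable def piB : H.PB →ₙ+* d.B' where
  toFun p := p
  map_mul' _ _ := rfl
  map_zero' := rfl
  map_add' _ _ := rfl

theorem piA_eq_zero_iff (p : H.PA) : d.piA p = 0 ↔ p ∈ d.imA := by
  change ((p : d.A') = ((0 : H.PA) : d.A')) ↔ _
  rw [RingCon.eq, TwoSidedIdeal.rel_iff, sub_zero]
  exact TwoSidedIdeal.mem_mk' _ _ _ _ _ _ _

theorem piB_eq_zero_iff (p : H.PB) : d.piB p = 0 ↔ p ∈ d.imB := by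
  change ((p : d.B') = ((0 : H.PB) : d.B')) ↔ _
  rw [RingCon.eq, TwoSidedIdeal.rel_iff, sub_zero]
  exact TwoSidedIdeal.mem_mk' _ _ _ _ _ _ _

end CoherdMaps

/-! ### The evaluation maps on `Tbar ⊗_S T` and `T ⊗_R Tbar` -/

/-- `Tbar ⊗_S T → A`, `(w ⊗ y) ⊗ z ↦ ev w * ev (y ⊗ z)`. -/
noncomputable def evBarA : H.PA →+ A :=
  BT.lift
    (fun u z => BT.lift (fun w y => H.ev w * H.ev (BT.tmul S y z))
      (fun _ _ _ => by rw [map_add, add_mul])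
      (fun _ _ _ => by rw [BT.add_tmul, map_add, mul_add])
      (fun w r y => by rw [H.ev_op_smul, Res.left_smul, H.ev_left, mul_assoc]) u.1)
    (fun _ _ _ => map_add _ _ _)
    (fun u z₁ z₂ => by
      generalize u.1 = u
      induction u using BT.induction with
      | h₀ => simp only [map_zero, add_zero]
      | ha v w hv hw => rw [map_add, map_add, map_add, hv, hw]; abel
      | h w y => simp only [BT.lift_tmul, BT.tmul_add, map_add, mul_add])
    (fun u s z => by
      change BT.lift _ _ _ _ (op s • u.1) = _
      generalize u.1 = u
      induction u using BT.induction with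
      | h₀ => simp only [smul_zero, map_zero]
      | ha v w hv hw => rw [smul_add, map_add, map_add, hv, hw]
      | h w y => simp only [BT.op_smul_tmul, BT.lift_tmul, BT.tmul_balanced])

/-- For `x ∈ T`, the map `(y ⊗ z) ⊗ y' ↦ evHat (x ⊗ y) * evHat (z ⊗ y')`. -/
noncomputable def evHatMul (x : Res β α T) : TX α β T T' →+ B :=
  BT.lift (fun w y' => BT.lift
      (fun y z => H.evHat (BT.tmul R x y) * H.evHat (BT.tmul R z y'))
      (fun _ _ _ => by rw [BT.tmul_add, map_add, add_mul])
      (fun _ _ _ => by rw [BT.add_tmul, map_add, mul_add])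
      (fun y s z => by
        rw [Res.right_smul, H.evHat_right, Res.left_smul, H.evHat_left, mul_assoc]) w)
    (fun _ _ _ => map_add _ _ _)
    (fun w y₁ y₂ => by
      induction w using BT.induction with
      | h₀ => simp only [map_zero, add_zero]
      | ha v w hv hw => rw [map_add, map_add, map_add, hv, hw]; abel
      | h w y => simp only [BT.lift_tmul, BT.tmul_add, map_add, mul_add])
    (fun w r y => by
      induction w using BT.induction with
      | h₀ => simp only [smul_zero, map_zero]
      | ha v w hv hw => rw [smul_add, map_add, map_add, hv, hw]
      | h w y => simp only [BT.op_smul_tmul, BT.lift_tmul, BT.tmul_balanced])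

/-- `T ⊗_R Tbar → B`, `x ⊗ ((y ⊗ z) ⊗ y') ↦ evHat (x ⊗ y) * evHat (z ⊗ y')`. -/
noncomputable def evBarB : H.PB →+ B :=
  BT.lift (fun x u => H.evHatMul x u.1)
    (fun x₁ x₂ u => by
      refine BT.hom_congr (f := H.evHatMul (x₁ + x₂)) (g := H.evHatMul x₁ + H.evHatMul x₂)
        (fun w y' => ?_) u.1
      induction w using BT.induction with
      | h₀ => simp only [BT.zero_tmul, map_zero]
      | ha v w hv hw => simp only [BT.add_tmul, map_add, hv, hw]
      | h y z => simp only [evHatMul, AddMonoidHom.add_apply, BT.lift_tmul, BT.add_tmul, map_add,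
          add_mul])
    (fun _ _ _ => map_add _ _ _)
    (fun x r u => by
      refine BT.hom_congr (f := H.evHatMul (op r • x))
        (g := (H.evHatMul x).comp (DistribSMul.toAddMonoidHom _ r)) (fun w y' => ?_) u.1
      induction w using BT.induction with
      | h₀ => simp only [BT.zero_tmul, map_zero]
      | ha v w hv hw => simp only [BT.add_tmul, map_add, hv, hw]
      | h y z => simp only [evHatMul, AddMonoidHom.comp_apply, DistribSMul.toAddMonoidHom_apply,
          BT.smul_tmul, BT.lift_tmul, BT.tmul_balanced])

end Herd
end Herds

/-! Compatibility of `ev` with `evHat` turns `χ (x ⊗ p)` into `x · evBarA p` for `p ∈ Tbar ⊗_S T`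
(`chiA_eq_smul`). Hence a product `p * q` depends on `q` only through `evBarA q`. As `ev` is onto,
`T` is faithful over `A`, and comparing actions on `T` shows that `evBarA` is multiplicative,
satisfies `evBarA (cov c) = ev c`, and so kills the relations `cov c * p - εC c • p`. Conversely,
choose `c ∈ C` with `ev c = 1`, so that `εC c = 1`. If `evBarA p = 0`, then `cov c * p = 0`, the
relation attached to `c` and `p` is `-p`, and `p` vanishes in `A'` (`mem_imA`). Moreover `cov c · a`
is sent to `a`. So `evBarA` induces a bijection `A' → A` for every tame herd, and the unit of `A'`
is the preimage of `1`.

The existence of `c` and of the four structure maps is a descent argument along `T`.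
Coassociativity, the counit laws and flatness place `γ x` in `T ⊗ C` and in `D ⊗ T` (`assoc_γ_mem`,
`γ_mem`). Applying `T ⊗ ev` gives `x ⊗ 1 ∈ T ⊗ ev(C)` for all `x`, whence `1 ∈ ev(C)` by faithful
flatness. If `c = ∑ yᵢ ⊗ zᵢ` lies in `C`, then `x ⊗ c = ∑ evHat (x ⊗ yᵢ) · γ zᵢ`, so a membership
statement about `C` can be tested after tensoring with `T`, where it becomes a statement about `γ`
(`tmul_mem_of_mem_C`). This yields `ev(C) ⊆ α(R)` and `(T' ⊗ γ)(C) ⊆ C ⊗ T' ⊗ T`. The second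
inclusion, together with `γ x ∈ D ⊗ T` and the fact that flat tensoring preserves intersections,
puts the values of `cov` in `Tbar ⊗_S T`. Uniqueness is injectivity of `α`, `β` and the two
canonical maps. The side of `D`, `B` and `B'` is the mirror image. -/

namespace BT

/-! ### Exactness and faithfully flat descent for right modules -/

section Flat

variable {R M N N' : Type u} [Ring R] [AddCommGroup M] [AddCommGroup N] [AddCommGroup N']
  [Module Rᵐᵒᵖ M] [Module R N] [Module R N']

/-- The image of `M ⊗_R N₀` in `M ⊗_R N`. -/
noncomputable def spanRight (M : Type u) [AddCommGroup M] [Module Rᵐᵒᵖ M] (N₀ : Submodule R N) :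
    AddSubgroup (BT R M N) :=
  AddSubgroup.closure {z | ∃ (m : M) (n : N), n ∈ N₀ ∧ z = tmul R m n}

theorem tmul_mem_spanRight {N₀ : Submodule R N} (m : M) {n : N} (hn : n ∈ N₀) :
    tmul R m n ∈ spanRight M N₀ := AddSubgroup.subset_closure ⟨m, n, hn, rfl⟩

theorem spanRight_le_range (N₀ : Submodule R N) :
    spanRight M N₀ ≤ (map (LinearMap.id : M →ₗ[Rᵐᵒᵖ] M) N₀.subtype).range := by
  refine (AddSubgroup.closure_le _).2 ?_
  rintro _ ⟨m, n, hn, rfl⟩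
  exact ⟨tmul R m ⟨n, hn⟩, rfl⟩

theorem map_mem_of_mem_spanRight {P : Type*} [AddCommGroup P] {N₀ : Submodule R N}
    (f : BT R M N →+ P) (X : AddSubgroup P) (h : ∀ m, ∀ n ∈ N₀, f (tmul R m n) ∈ X)
    {z : BT R M N} (hz : z ∈ spanRight M N₀) : f z ∈ X := by
  have : spanRight M N₀ ≤ X.comap f := by
    refine (AddSubgroup.closure_le _).2 ?_
    rintro _ ⟨m, n, hn, rfl⟩
    exact h m n hn
  exact this hz

theorem map_mkQ_eq_zero {N₀ : Submodule R N} {z : BT R M N} (hz : z ∈ spanRight M N₀) :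
    map (LinearMap.id : M →ₗ[Rᵐᵒᵖ] M) N₀.mkQ z = 0 :=
  map_mem_of_mem_spanRight (map LinearMap.id N₀.mkQ) ⊥
    (fun m n hn => by
      rw [map_tmul, Submodule.mkQ_apply, (Submodule.Quotient.mk_eq_zero N₀).2 hn, tmul_zero]
      exact zero_mem _) hz

/-- Right exactness of `M ⊗_R -`. -/
theorem mem_spanRight_of_map_rangeRestrict (g : N →ₗ[R] N') {z : BT R M N}
    (hz : map (LinearMap.id : M →ₗ[Rᵐᵒᵖ] M) g.rangeRestrict z = 0) :
    z ∈ spanRight M (LinearMap.ker g) := by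
  let π := QuotientAddGroup.mk' (spanRight M (LinearMap.ker g))
  -- Modulo the image of `M ⊗ ker g`, the class of `m ⊗ n` depends only on `m` and `g n`. Sending `m
  -- ⊗ p` to the class of `m ⊗ n`, for a chosen preimage `n` of `p`, is therefore a well-defined map
  -- `f`, and `f` composed with `M ⊗ g` is the quotient map.
  have wd : ∀ (m : M) (n n' : N), g n = g n' → π (tmul R m n) = π (tmul R m n') := by
    intro m n n' h
    refine (QuotientAddGroup.eq_iff_sub_mem).2 ?_
    have : tmul R m n - tmul R m n' = tmul R m (n - n') := by
      rw [sub_eq_iff_eq_add, ← tmul_add, sub_add_cancel]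
    rw [this]
    exact tmul_mem_spanRight m (by rw [LinearMap.mem_ker, map_sub, h, sub_self])
  have sec : ∀ p : LinearMap.range g, g p.2.choose = p := fun p => p.2.choose_spec
  let f : BT R M (LinearMap.range g) →+ BT R M N ⧸ spanRight M (LinearMap.ker g) :=
    lift (fun m p => π (tmul R m p.2.choose)) (fun _ _ _ => by rw [add_tmul, map_add])
      (fun m p q => by
        rw [← map_add, ← tmul_add]
        exact wd _ _ _ (by rw [map_add, sec, sec, sec]; rfl))
      (fun m r p => by
        rw [tmul_balanced]
        exact wd _ _ _ (by rw [map_smul, sec, sec]; rfl))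
  have key : ∀ z, f (map LinearMap.id g.rangeRestrict z) = π z :=
    hom_congr (f := f.comp (map LinearMap.id g.rangeRestrict)) (g := π)
      (fun m n => wd _ _ _ (sec _))
  have := key z
  rw [hz, map_zero] at this
  exact (QuotientAddGroup.eq_zero_iff z).1 this.symm

/-- Right exactness handles the surjection of `N` onto the range of `g`; flatness is needed only to
pass from the range to `N'`. -/
theorem mem_spanRight_ker (hM : FlatRight R M) (g : N →ₗ[R] N') {z : BT R M N}
    (hz : map (LinearMap.id : M →ₗ[Rᵐᵒᵖ] M) g z = 0) : z ∈ spanRight M (LinearMap.ker g) := by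
  refine mem_spanRight_of_map_rangeRestrict g ?_
  refine hM _ _ (LinearMap.range g).subtype Subtype.val_injective ?_
  rw [map_zero, ← hz]
  exact hom_congr (f := (map LinearMap.id (LinearMap.range g).subtype).comp
    (map LinearMap.id g.rangeRestrict)) (g := map LinearMap.id g) (fun _ _ => rfl) z

/-- The intersection is the kernel of `N₁ → N ⧸ N₂`. An element coming from `M ⊗ N₁` that also comes
from `M ⊗ N₂` dies in `M ⊗ (N ⧸ N₂)`, so flatness applies to this kernel. -/
theorem mem_spanRight_inf (hM : FlatRight R M) {N₁ N₂ : Submodule R N} {z : BT R M N}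
    (h₁ : z ∈ spanRight M N₁) (h₂ : z ∈ spanRight M N₂) : z ∈ spanRight M (N₁ ⊓ N₂) := by
  obtain ⟨w, rfl⟩ := spanRight_le_range N₁ h₁
  have hw : w ∈ spanRight M (LinearMap.ker (N₂.mkQ.comp N₁.subtype)) := by
    refine mem_spanRight_ker hM _ ?_
    rw [← map_mkQ_eq_zero h₂]
    exact hom_congr (f := map LinearMap.id (N₂.mkQ.comp N₁.subtype))
      (g := (map LinearMap.id N₂.mkQ).comp (map LinearMap.id N₁.subtype)) (fun _ _ => rfl) w
  refine map_mem_of_mem_spanRight (map LinearMap.id N₁.subtype) _ (fun m n hn => ?_) hw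
  exact tmul_mem_spanRight m ⟨n.2, (Submodule.Quotient.mk_eq_zero N₂).1 hn⟩

/-- A faithfully flat right module detects membership in submodules. -/
theorem mem_of_tmul_mem_spanRight (hM : FaithfullyFlatRight R M) {N₀ : Submodule R N} {n : N}
    (h : ∀ m : M, tmul R m n ∈ spanRight M N₀) : n ∈ N₀ := by
  -- The cyclic submodule generated by the class of `n` in `N ⧸ N₀` becomes zero after tensoring:
  -- its image in `M ⊗ (N ⧸ N₀)` vanishes because `m ⊗ r n = m r ⊗ n`, and flatness makes the map to
  -- that group injective.
  have : Subsingleton (Submodule.span R {N₀.mkQ n}) := by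
    refine hM.2 _ ⟨fun z z' => ?_⟩
    have key : ∀ z, map (LinearMap.id : M →ₗ[Rᵐᵒᵖ] M)
        (Submodule.span R {N₀.mkQ n}).subtype z = 0 :=
      hom_congr (f := map LinearMap.id _) (g := 0) (fun m p => by
        obtain ⟨r, hr⟩ := Submodule.mem_span_singleton.1 p.2
        rw [map_tmul, Submodule.subtype_apply, ← hr, ← tmul_balanced]
        exact map_mkQ_eq_zero (h _))
    exact hM.1 _ _ _ Subtype.val_injective ((key z).trans (key z').symm)
  have h₀ := congrArg Subtype.val
    (Subsingleton.elim (⟨N₀.mkQ n, Submodule.mem_span_singleton_self _⟩ :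
      Submodule.span R {N₀.mkQ n}) 0)
  exact (Submodule.Quotient.mk_eq_zero N₀).1 h₀

end Flat

/-! ### The mirror statements for left modules -/

section FlatLeft

variable {R M M' N : Type u} [Ring R] [AddCommGroup M] [AddCommGroup M'] [AddCommGroup N]
  [Module Rᵐᵒᵖ M] [Module Rᵐᵒᵖ M'] [Module R N]

/-- The image of `M₀ ⊗_R N` in `M ⊗_R N`. -/
noncomputable def spanLeft (N : Type u) [AddCommGroup N] [Module R N] (M₀ : Submodule Rᵐᵒᵖ M) :
    AddSubgroup (BT R M N) :=
  AddSubgroup.closure {z | ∃ (m : M) (n : N), m ∈ M₀ ∧ z = tmul R m n}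

theorem tmul_mem_spanLeft {M₀ : Submodule Rᵐᵒᵖ M} {m : M} (hm : m ∈ M₀) (n : N) :
    tmul R m n ∈ spanLeft N M₀ := AddSubgroup.subset_closure ⟨m, n, hm, rfl⟩

theorem spanLeft_le_range (M₀ : Submodule Rᵐᵒᵖ M) :
    spanLeft N M₀ ≤ (map M₀.subtype (LinearMap.id : N →ₗ[R] N)).range := by
  refine (AddSubgroup.closure_le _).2 ?_
  rintro _ ⟨m, n, hm, rfl⟩
  exact ⟨tmul R ⟨m, hm⟩ n, rfl⟩

theorem map_mem_of_mem_spanLeft {P : Type*} [AddCommGroup P] {M₀ : Submodule Rᵐᵒᵖ M}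
    (f : BT R M N →+ P) (X : AddSubgroup P) (h : ∀ m ∈ M₀, ∀ n, f (tmul R m n) ∈ X)
    {z : BT R M N} (hz : z ∈ spanLeft N M₀) : f z ∈ X := by
  have : spanLeft N M₀ ≤ X.comap f := by
    refine (AddSubgroup.closure_le _).2 ?_
    rintro _ ⟨m, n, hm, rfl⟩
    exact h m hm n
  exact this hz

theorem mkQ_map_eq_zero {M₀ : Submodule Rᵐᵒᵖ M} {z : BT R M N} (hz : z ∈ spanLeft N M₀) :
    map M₀.mkQ (LinearMap.id : N →ₗ[R] N) z = 0 :=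
  map_mem_of_mem_spanLeft (map M₀.mkQ LinearMap.id) ⊥
    (fun m hm n => by
      rw [map_tmul, Submodule.mkQ_apply, (Submodule.Quotient.mk_eq_zero M₀).2 hm, zero_tmul]
      exact zero_mem _) hz

/-- Right exactness of `- ⊗_R N`. -/
theorem mem_spanLeft_of_rangeRestrict_map (g : M →ₗ[Rᵐᵒᵖ] M') {z : BT R M N}
    (hz : map g.rangeRestrict (LinearMap.id : N →ₗ[R] N) z = 0) :
    z ∈ spanLeft N (LinearMap.ker g) := by
  let π := QuotientAddGroup.mk' (spanLeft N (LinearMap.ker g))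
  have wd : ∀ (m m' : M) (n : N), g m = g m' → π (tmul R m n) = π (tmul R m' n) := by
    intro m m' n h
    refine (QuotientAddGroup.eq_iff_sub_mem).2 ?_
    have : tmul R m n - tmul R m' n = tmul R (m - m') n := by
      rw [sub_eq_iff_eq_add, ← add_tmul, sub_add_cancel]
    rw [this]
    exact tmul_mem_spanLeft (by rw [LinearMap.mem_ker, map_sub, h, sub_self]) n
  have sec : ∀ p : LinearMap.range g, g p.2.choose = p := fun p => p.2.choose_spec
  let f : BT R (LinearMap.range g) N →+ BT R M N ⧸ spanLeft N (LinearMap.ker g) :=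
    lift (fun p n => π (tmul R p.2.choose n))
      (fun p q n => by
        rw [← map_add, ← add_tmul]
        exact wd _ _ _ (by rw [map_add, sec, sec, sec]; rfl))
      (fun _ _ _ => by rw [tmul_add, map_add])
      (fun p r n => by
        rw [← tmul_balanced]
        exact wd _ _ _ (by rw [map_smul, sec, sec]; rfl))
  have key : ∀ z, f (map g.rangeRestrict LinearMap.id z) = π z :=
    hom_congr (f := f.comp (map g.rangeRestrict LinearMap.id)) (g := π)
      (fun m n => wd _ _ _ (sec _))
  have := key z
  rw [hz, map_zero] at this
  exact (QuotientAddGroup.eq_zero_iff z).1 this.symm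

theorem mem_spanLeft_ker (hN : FlatLeft R N) (g : M →ₗ[Rᵐᵒᵖ] M') {z : BT R M N}
    (hz : map g (LinearMap.id : N →ₗ[R] N) z = 0) : z ∈ spanLeft N (LinearMap.ker g) := by
  refine mem_spanLeft_of_rangeRestrict_map g ?_
  refine hN _ _ (LinearMap.range g).subtype Subtype.val_injective ?_
  rw [map_zero, ← hz]
  exact hom_congr (f := (map (LinearMap.range g).subtype LinearMap.id).comp
    (map g.rangeRestrict LinearMap.id)) (g := map g LinearMap.id) (fun _ _ => rfl) z

theorem mem_spanLeft_inf (hN : FlatLeft R N) {M₁ M₂ : Submodule Rᵐᵒᵖ M} {z : BT R M N}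
    (h₁ : z ∈ spanLeft N M₁) (h₂ : z ∈ spanLeft N M₂) : z ∈ spanLeft N (M₁ ⊓ M₂) := by
  obtain ⟨w, rfl⟩ := spanLeft_le_range M₁ h₁
  have hw : w ∈ spanLeft N (LinearMap.ker (M₂.mkQ.comp M₁.subtype)) := by
    refine mem_spanLeft_ker hN _ ?_
    rw [← mkQ_map_eq_zero h₂]
    exact hom_congr (f := map (M₂.mkQ.comp M₁.subtype) LinearMap.id)
      (g := (map M₂.mkQ LinearMap.id).comp (map M₁.subtype LinearMap.id)) (fun _ _ => rfl) w
  refine map_mem_of_mem_spanLeft (map M₁.subtype LinearMap.id) _ (fun m hm n => ?_) hw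
  exact tmul_mem_spanLeft (M₀ := M₁ ⊓ M₂) ⟨m.2, (Submodule.Quotient.mk_eq_zero M₂).1 hm⟩ n

/-- A faithfully flat left module detects membership in submodules. -/
theorem mem_of_tmul_mem_spanLeft (hN : FaithfullyFlatLeft R N) {M₀ : Submodule Rᵐᵒᵖ M} {m : M}
    (h : ∀ n : N, tmul R m n ∈ spanLeft N M₀) : m ∈ M₀ := by
  have : Subsingleton (Submodule.span Rᵐᵒᵖ {M₀.mkQ m}) := by
    refine hN.2 _ ⟨fun z z' => ?_⟩
    have key : ∀ z, map (Submodule.span Rᵐᵒᵖ {M₀.mkQ m}).subtype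
        (LinearMap.id : N →ₗ[R] N) z = 0 :=
      hom_congr (f := map _ LinearMap.id) (g := 0) (fun p n => by
        obtain ⟨r, hr⟩ := Submodule.mem_span_singleton.1 p.2
        obtain ⟨r, rfl⟩ := op_surjective r
        rw [map_tmul, Submodule.subtype_apply, ← hr, LinearMap.id_apply, tmul_balanced]
        exact mkQ_map_eq_zero (h _))
    exact hN.1 _ _ _ Subtype.val_injective ((key z).trans (key z').symm)
  have h₀ := congrArg Subtype.val
    (Subsingleton.elim (⟨M₀.mkQ m, Submodule.mem_span_singleton_self _⟩ :
      Submodule.span Rᵐᵒᵖ {M₀.mkQ m}) 0)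
  exact (Submodule.Quotient.mk_eq_zero M₀).1 h₀

end FlatLeft

end BT

/-! ### Threefold tensor products and linearity of induced maps -/

namespace BT

variable {R S L K : Type*} [Ring R] [Ring S] [Ring L] [Ring K] {M N N' Q P : Type*}
  [AddCommGroup M] [AddCommGroup N] [AddCommGroup N'] [AddCommGroup Q] [AddCommGroup P]
  [Module Rᵐᵒᵖ M] [Module R N] [Module R N'] [Module S Q] [Module Sᵐᵒᵖ N]
  [SMulCommClass R Sᵐᵒᵖ N]

theorem hom_congr₃ {f g : BT S (BT R M N) Q →+ P}
    (h : ∀ m n q, f (tmul S (tmul R m n) q) = g (tmul S (tmul R m n) q))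
    (z : BT S (BT R M N) Q) : f z = g z := by
  refine hom_congr (fun v q => ?_) z
  induction v using induction with
  | h₀ => rw [zero_tmul, map_zero, map_zero]
  | ha v w hv hw => rw [add_tmul, map_add, map_add, hv, hw]
  | h m n => exact h m n q

/-- `m ⊗ -` as an additive map. -/
noncomputable def tmulLeft (N : Type*) [AddCommGroup N] [Module R N] (m : M) : N →+ BT R M N :=
  AddMonoidHom.mk' (tmul R m) (tmul_add R m)

/-- `- ⊗ n` as an additive map. -/
noncomputable def tmulRight (M : Type*) [AddCommGroup M] [Module Rᵐᵒᵖ M] (n : N) : M →+ BT R M N :=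
  AddMonoidHom.mk' (fun m => tmul R m n) (fun m₁ m₂ => add_tmul R m₁ m₂ n)

/-- Associativity as a right linear map. -/
noncomputable def assocLinear [Module Lᵐᵒᵖ Q] [SMulCommClass S Lᵐᵒᵖ Q] :
    BT S (BT R M N) Q →ₗ[Lᵐᵒᵖ] BT R M (BT S N Q) where
  toFun := assoc
  map_add' := map_add _
  map_smul' l z := hom_congr₃ (f := assoc.comp (DistribSMul.toAddMonoidHom _ l))
    (g := (DistribSMul.toAddMonoidHom _ l).comp assoc) (fun _ _ _ => rfl) z

theorem map_id_smul [Module K M] [SMulCommClass K Rᵐᵒᵖ M] (g : N →ₗ[R] N') (k : K)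
    (z : BT R M N) : map LinearMap.id g (k • z) = k • map (LinearMap.id : M →ₗ[Rᵐᵒᵖ] M) g z :=
  hom_congr (f := (map LinearMap.id g).comp (DistribSMul.toAddMonoidHom _ k))
    (g := (DistribSMul.toAddMonoidHom _ k).comp (map LinearMap.id g)) (fun _ _ => rfl) z

theorem map_id_op_smul {M M' N : Type*} [AddCommGroup M] [AddCommGroup M'] [AddCommGroup N]
    [Module Rᵐᵒᵖ M] [Module Rᵐᵒᵖ M'] [Module R N] [Module Lᵐᵒᵖ N] [SMulCommClass R Lᵐᵒᵖ N]
    (f : M →ₗ[Rᵐᵒᵖ] M') (l : Lᵐᵒᵖ) (z : BT R M N) :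
    map f LinearMap.id (l • z) = l • map f (LinearMap.id : N →ₗ[R] N) z :=
  hom_congr (f := (map f LinearMap.id).comp (DistribSMul.toAddMonoidHom _ l))
    (g := (DistribSMul.toAddMonoidHom _ l).comp (map f LinearMap.id)) (fun _ _ => rfl) z

end BT

/-! ### Where the shepherd takes its values, and elements evaluating to one -/

namespace Herd

variable {R S A B : Type u} [Ring R] [Ring S] [Ring A] [Ring B] {α : R →+* A} {β : S →+* B}
  {T T' : Type u} [AddCommGroup T] [AddCommGroup T'] [Module B T] [Module Aᵐᵒᵖ T]
  [SMulCommClass B Aᵐᵒᵖ T] [Module A T'] [Module Bᵐᵒᵖ T'] [SMulCommClass A Bᵐᵒᵖ T']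

/-- The inverse of `joinX`, as a right `S`-linear map. -/
noncomputable def splitX :
    BT R (TG α β T T') (Res α β T') →ₗ[Sᵐᵒᵖ] BT R (Res β α T) (TX α β T T') :=
  BT.assocLinear.comp (BT.mapL BT.assocLinear)

theorem splitX_joinX (z : BT R (Res β α T) (TX α β T T')) : splitX (joinX z) = z := by
  refine BT.hom_congr (f := splitX.toAddMonoidHom.comp joinX) (g := AddMonoidHom.id _)
    (fun x u => ?_) z
  exact BT.hom_congr₃ (f := splitX.toAddMonoidHom.comp (insertX x))
    (g := BT.tmulLeft (TX α β T T') x) (fun _ _ _ => rfl) u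

theorem joinX_splitX (z : BT R (TG α β T T') (Res α β T')) : joinX (splitX z) = z := by
  refine BT.hom_congr (f := joinX.comp splitX.toAddMonoidHom) (g := AddMonoidHom.id _)
    (fun g y => ?_) z
  exact BT.hom_congr₃ (f := (joinX.comp splitX.toAddMonoidHom).comp
    (BT.tmulRight (TG α β T T') y))
    (g := (BT.tmulRight (TG α β T T') y)) (fun _ _ _ => rfl) g

variable (α β T T') in
/-- The associativity map from `(T ⊗_R T') ⊗_S T ⊗_R T' ⊗_S T` to
`T ⊗_R (T' ⊗_S T ⊗_R T' ⊗_S T)`. -/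
noncomputable def splitExt :
    TExt α β T T' (TV α β T T') →+ BT R (Res β α T) (BT S (TX α β T T') (Res β α T)) :=
  BT.assoc.comp (BT.map splitX LinearMap.id)

variable (H : Herd α β T T')

/-- `T' ⊗ γ` as a left `R`-linear map. -/
noncomputable def idγLeft : TW α β T T' →ₗ[R] BT S (TX α β T T') (Res β α T) where
  toFun := H.idγ
  map_add' := map_add _
  map_smul' r w := by
    refine BT.hom_congr (f := H.idγ.comp (DistribSMul.toAddMonoidHom _ r))
      (g := (DistribSMul.toAddMonoidHom _ r).comp H.idγ) (fun y x => ?_) w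
    exact BT.hom_congr₃ (f := insertG (r • y))
      (g := (DistribSMul.toAddMonoidHom _ r).comp (insertG y)) (fun _ _ _ => rfl) (H.γ x)

/-- `γ ⊗ T'` as a right `S`-linear map. -/
noncomputable def γidRight :
    TV α β T T' →ₗ[Sᵐᵒᵖ] BT R (TG α β T T') (Res α β T') := BT.mapL H.γRight

/-- Coassociativity is stated with brackets to the left, whereas descent along the left factor `T`
needs brackets to the right. This is the bridge between the two. -/
theorem map_idγLeft_assoc (g : TG α β T T') :
    BT.map LinearMap.id H.idγLeft (BT.assoc g) =
      splitExt α β T T' (joinG _ (BT.map LinearMap.id H.γLeft g)) := by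
  have key : ∀ (x : Res β α T) (y : Res α β T') (g : TG α β T T'),
      BT.tmul R x (insertG y g) = splitExt α β T T' (insertG (BT.tmul R x y) g) := fun x y =>
    BT.hom_congr₃ (f := (BT.tmulLeft (BT S (TX α β T T') (Res β α T)) x).comp (insertG y))
      (g := (splitExt α β T T').comp (insertG (BT.tmul R x y))) (fun _ _ _ => rfl)
  exact BT.hom_congr₃ (f := (BT.map LinearMap.id H.idγLeft).comp BT.assoc)
    (g := (splitExt α β T T').comp
      ((joinG (TV α β T T')).comp (BT.map LinearMap.id H.γLeft)))
    (fun x y z => key x y (H.γ z)) g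

theorem coassoc' (x : Res β α T) :
    BT.map H.γidRight LinearMap.id (H.γ x) =
      joinG _ (BT.map LinearMap.id H.γLeft (H.γ x)) := H.coassoc x

/-- `C` as a left `R`-submodule. -/
noncomputable def leftC : Submodule R (TW α β T T') :=
  { H.C with smul_mem' := fun r _ hw => H.smul_mem_C r hw }

/-- `D` as a right `S`-submodule. -/
noncomputable def rightD : Submodule Sᵐᵒᵖ (TV α β T T') :=
  { H.D with smul_mem' := fun s _ hv => H.op_smul_mem_D s.unop hv }

/-- `ev ⊗ T' ⊗ T` on `T' ⊗_S T ⊗_R T' ⊗_S T`, as a left `R`-linear map. -/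
noncomputable def evExt : BT S (TX α β T T') (Res β α T) →ₗ[R]
    BT S (BT R (Res α α A) (Res α β T')) (Res β α T) where
  toFun := BT.map (BT.mapL H.evRight) LinearMap.id
  map_add' := map_add _
  map_smul' r z := BT.hom_congr₃
    (f := (BT.map (BT.mapL (L := S) H.evRight) LinearMap.id).comp
      (DistribSMul.toAddMonoidHom _ r))
    (g := (DistribSMul.toAddMonoidHom _ r).comp (BT.map (BT.mapL (L := S) H.evRight) LinearMap.id))
    (fun w y z => congrArg (fun a => BT.tmul S (BT.tmul R a y) z) (H.evLeft.map_smul r w)) z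

/-- `α ⊗ T' ⊗ T` as a left `R`-linear map. -/
noncomputable def zetaLeft : TW α β T T' →ₗ[R]
    BT S (BT R (Res α α A) (Res α β T')) (Res β α T) where
  toFun := zetaC α β T T'
  map_add' := map_add _
  map_smul' := zetaC_smul

/-- The shepherd takes values in `T ⊗_R C`. -/
theorem assoc_γ_mem (hR : FlatRight R (Res β α T)) (x : Res β α T) :
    BT.assoc (H.γ x) ∈ BT.spanRight (Res β α T) H.leftC := by
  -- The equaliser `C` is written as the kernel of a difference of left `R`-linear maps, so that
  -- flatness of `T` computes the kernel after tensoring.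
  have hker : LinearMap.ker (H.evExt.comp H.idγLeft - zetaLeft) = H.leftC := by
    ext w
    exact sub_eq_zero
  rw [← hker]
  refine BT.mem_spanRight_ker hR _ ?_
  have hsub : ∀ z : BT R (Res β α T) (TW α β T T'),
      BT.map LinearMap.id (H.evExt.comp H.idγLeft - zetaLeft) z =
        BT.map LinearMap.id H.evExt (BT.map LinearMap.id H.idγLeft z) -
          BT.map LinearMap.id zetaLeft z :=
    BT.hom_congr (f := BT.map LinearMap.id (H.evExt.comp H.idγLeft - zetaLeft))
      (g := (BT.map LinearMap.id H.evExt).comp (BT.map LinearMap.id H.idγLeft) -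
        BT.map LinearMap.id zetaLeft)
      (fun x w => (map_sub (BT.tmulLeft _ x) _ _))
  -- Coassociativity replaces `(T ⊗ T' ⊗ γ) γ` by `(γ ⊗ T' ⊗ T) γ`; now `ev` meets only the two
  -- inner factors of the new copy of `γ`.
  rw [hsub, map_idγLeft_assoc, ← coassoc', sub_eq_zero]
  refine BT.hom_congr₃ (f := (BT.map LinearMap.id H.evExt).comp ((splitExt α β T T').comp
    (BT.map H.γidRight LinearMap.id))) (g := (BT.map LinearMap.id zetaLeft).comp BT.assoc)
    (fun x y z => ?_) (H.γ x)
  let f : Res α α A →ₗ[R] BT S (BT R (Res α α A) (Res α β T')) (Res β α T) :=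
    (BT.mkR (K := R) z).comp (BT.mkR (K := R) y)
  have key : ∀ g : TG α β T T', BT.map LinearMap.id H.evExt
      (splitExt α β T T' (BT.tmul S (BT.tmul R g y) z)) =
        BT.map LinearMap.id f (BT.map LinearMap.id H.evLeft (BT.assoc g)) :=
    BT.hom_congr₃
      (f := ((BT.map LinearMap.id H.evExt).comp (splitExt α β T T')).comp
        ((BT.tmulRight _ z).comp (BT.tmulRight _ y)))
      (g := (BT.map LinearMap.id f).comp ((BT.map LinearMap.id H.evLeft).comp BT.assoc))
      (fun _ _ _ => rfl)
  -- On a term `x ⊗ y ⊗ z` of `γ`, the counit law `(T ⊗ ev)(γ x) = x ⊗ 1` leaves `x ⊗ (1 ⊗ y ⊗ z)`,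
  -- which is the value of `T ⊗ zetaC`.
  refine (key (H.γ x)).trans ?_
  rw [H.counit_right]
  rfl

/-- `(T ⊗_R T') ⊗ evHat`, as a right `S`-linear map. -/
noncomputable def evHatExt :
    BT R (TG α β T T') (Res α β T') →ₗ[Sᵐᵒᵖ] BT S (TV α β T T') (Res β β B) where
  toFun z := BT.map LinearMap.id H.evHatLeft (BT.assoc z)
  map_add' _ _ := by rw [map_add, map_add]
  map_smul' s z := BT.hom_congr₃
    (f := ((BT.map (LinearMap.id : TV α β T T' →ₗ[Sᵐᵒᵖ] _) H.evHatLeft).comp BT.assoc).comp (DistribSMul.toAddMonoidHom _ s))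
    (g := (DistribSMul.toAddMonoidHom _ s).comp ((BT.map (LinearMap.id : TV α β T T' →ₗ[Sᵐᵒᵖ] _) H.evHatLeft).comp BT.assoc))
    (fun v x y => congrArg (BT.tmul S v) (H.evHatRight.map_smul s (BT.tmul R x y))) z

/-- `T ⊗ T' ⊗ β` as a right `S`-linear map. -/
noncomputable def zetaRight :
    TV α β T T' →ₗ[Sᵐᵒᵖ] BT S (TV α β T T') (Res β β B) where
  toFun := zetaD α β T T'
  map_add' := map_add _
  map_smul' s := zetaD_smul s.unop

/-- The shepherd takes values in `D ⊗_S T`. -/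
theorem γ_mem (hS : FlatLeft S (Res β α T)) (x : Res β α T) :
    H.γ x ∈ BT.spanLeft (Res β α T) H.rightD := by
  have hker : LinearMap.ker (H.evHatExt.comp H.γidRight - zetaRight) = H.rightD := by
    ext w
    exact sub_eq_zero
  rw [← hker]
  refine BT.mem_spanLeft_ker hS _ ?_
  have hsub : ∀ z : TG α β T T',
      BT.map (H.evHatExt.comp H.γidRight - zetaRight) LinearMap.id z =
        BT.map H.evHatExt LinearMap.id (BT.map H.γidRight LinearMap.id z) -
          BT.map zetaRight LinearMap.id z :=
    BT.hom_congr (f := BT.map (H.evHatExt.comp H.γidRight - zetaRight) LinearMap.id)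
      (g := (BT.map H.evHatExt LinearMap.id).comp (BT.map H.γidRight LinearMap.id) -
        BT.map zetaRight LinearMap.id)
      (fun v z => (map_sub (BT.tmulRight _ z) _ _))
  -- Here coassociativity is used in the other direction: the second `γ` is moved to the last
  -- factor, where the counit law for `evHat` applies.
  rw [hsub, coassoc', sub_eq_zero]
  refine BT.hom_congr (f := (BT.map H.evHatExt LinearMap.id).comp ((joinG _).comp
    (BT.map LinearMap.id H.γLeft))) (g := BT.map zetaRight LinearMap.id)
    (fun v z => ?_) (H.γ x)
  have key : ∀ g : TG α β T T', BT.map H.evHatExt LinearMap.id (insertG v g) =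
      BT.map (BT.mkL (L := S) v) LinearMap.id (BT.map H.evHatRight LinearMap.id g) :=
    BT.hom_congr₃ (f := (BT.map H.evHatExt LinearMap.id).comp (insertG v))
      (g := (BT.map (BT.mkL (L := S) v) LinearMap.id).comp (BT.map H.evHatRight LinearMap.id))
      (fun _ _ _ => rfl)
  refine (key (H.γ z)).trans ?_
  rw [H.counit_left]
  rfl

/-- `ev` is onto `R` on `C`. -/
theorem exists_ev_eq_one (hR : FaithfullyFlatRight R (Res β α T)) : ∃ c ∈ H.C, H.ev c = 1 := by
  have : Res.of α α A 1 ∈ H.leftC.map H.evLeft := by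
    -- By the counit law `x ⊗ 1 = (T ⊗ ev)(γ x)`, and `γ x` comes from `T ⊗ C`.
    refine BT.mem_of_tmul_mem_spanRight hR fun x => ?_
    rw [← H.counit_right]
    exact BT.map_mem_of_mem_spanRight (BT.map LinearMap.id H.evLeft) _
      (fun x c hc => BT.tmul_mem_spanRight x (Submodule.mem_map_of_mem hc)) (H.assoc_γ_mem hR.1 x)
  obtain ⟨c, hc, e⟩ := this
  exact ⟨c, hc, e⟩

/-- `evHat` is onto `S` on `D`. -/
theorem exists_evHat_eq_one (hS : FaithfullyFlatLeft S (Res β α T)) :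
    ∃ d ∈ H.D, H.evHat d = 1 := by
  have : Res.of β β B 1 ∈ H.rightD.map H.evHatRight := by
    refine BT.mem_of_tmul_mem_spanLeft hS fun x => ?_
    rw [← H.counit_left]
    exact BT.map_mem_of_mem_spanLeft (BT.map H.evHatRight LinearMap.id) _
      (fun d hd x => BT.tmul_mem_spanLeft (Submodule.mem_map_of_mem hd) x) (H.γ_mem hS.1 x)
  obtain ⟨d, hd, e⟩ := this
  exact ⟨d, hd, e⟩

end Herd

/-! ### Lifting through injections and descending to quotients -/

theorem AddMonoidHom.exists_comp_eq_of_injective {X Y Z : Type*} [AddCommGroup X] [AddCommGroup Y]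
    [AddCommGroup Z] (f : X →+ Y) (hf : Function.Injective f) (g : Z →+ Y)
    (h : ∀ z, g z ∈ f.range) : ∃ k : Z →+ X, ∀ z, f (k z) = g z := by
  refine ⟨(AddMonoidHom.ofInjective hf).symm.toAddMonoidHom.comp (g.codRestrict f.range h),
    fun z => ?_⟩
  exact congrArg Subtype.val
    ((AddMonoidHom.ofInjective hf).apply_symm_apply (g.codRestrict f.range h z))

/-- A nonunital ring map killing a two-sided ideal descends to the quotient. -/
noncomputable def TwoSidedIdeal.quotientLift {P A : Type*} [NonUnitalRing P] [Ring A]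
    (I : TwoSidedIdeal P) (f : P →ₙ+* A) (h : ∀ x ∈ I, f x = 0) : I.ringCon.Quotient →ₙ+* A where
  toFun := Quotient.lift f fun x y hxy => by
    rw [← sub_eq_zero, ← map_sub]
    exact h _ ((TwoSidedIdeal.rel_iff I x y).1 hxy)
  map_zero' := map_zero f
  map_add' := Quotient.ind₂ (map_add f)
  map_mul' := Quotient.ind₂ (map_mul f)

namespace BT

variable {R S : Type*} [Ring R] [Ring S] {M N Q P : Type*}
  [AddCommGroup M] [AddCommGroup N] [AddCommGroup Q] [AddCommGroup P]
  [Module Rᵐᵒᵖ M] [Module R N] [Module S Q] [Module Sᵐᵒᵖ N] [SMulCommClass R Sᵐᵒᵖ N]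

/-- Membership in `X` is the vanishing of the composite with `P → P ⧸ X`, and vanishing can be
tested on pure tensors. -/
theorem map_mem_of_tmul {f : BT R M N →+ P} {X : AddSubgroup P}
    (h : ∀ m n, f (tmul R m n) ∈ X) (z : BT R M N) : f z ∈ X :=
  (QuotientAddGroup.eq_zero_iff _).1 (hom_congr (f := (QuotientAddGroup.mk' X).comp f) (g := 0)
    (fun m n => (QuotientAddGroup.eq_zero_iff _).2 (h m n)) z)

theorem map_mem_of_tmul₃ {f : BT S (BT R M N) Q →+ P} {X : AddSubgroup P}
    (h : ∀ m n q, f (tmul S (tmul R m n) q) ∈ X) (z : BT S (BT R M N) Q) : f z ∈ X :=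
  (QuotientAddGroup.eq_zero_iff _).1 (hom_congr₃ (f := (QuotientAddGroup.mk' X).comp f) (g := 0)
    (fun m n q => (QuotientAddGroup.eq_zero_iff _).2 (h m n q)) z)

end BT

/-! ### Descent along `T`: from the shepherd to `C` and `D` -/

namespace Herd

variable {R S A B : Type u} [Ring R] [Ring S] [Ring A] [Ring B] {α : R →+* A} {β : S →+* B}
  {T T' : Type u} [AddCommGroup T] [AddCommGroup T'] [Module B T] [Module Aᵐᵒᵖ T]
  [SMulCommClass B Aᵐᵒᵖ T] [Module A T'] [Module Bᵐᵒᵖ T'] [SMulCommClass A Bᵐᵒᵖ T']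

/-- If `α r = 0`, then `x ⊗ r = x α(r) ⊗ 1 = 0` in `T ⊗_R R` for every `x`, so faithful flatness
puts `r` in the zero submodule. -/
theorem injective_left (hR : FaithfullyFlatRight R (Res β α T)) : Function.Injective α := by
  refine (injective_iff_map_eq_zero α).2 fun r hr => ?_
  refine (Submodule.mem_bot R).1 (BT.mem_of_tmul_mem_spanRight hR fun x => ?_)
  have : BT.tmul R x r = BT.tmul R (op r • x) 1 := by rw [BT.tmul_balanced, smul_eq_mul, mul_one]
  rw [this, Res.right_smul, hr, op_zero, zero_smul, BT.zero_tmul]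
  exact zero_mem _

theorem injective_right (hS : FaithfullyFlatLeft S (Res β α T)) : Function.Injective β := by
  refine (injective_iff_map_eq_zero β).2 fun s hs => ?_
  refine (Submodule.mem_bot Sᵐᵒᵖ).1 (BT.mem_of_tmul_mem_spanLeft hS fun x => ?_)
  have : BT.tmul S s x = BT.tmul S 1 (s • x) := by
    rw [← BT.tmul_balanced, op_smul_eq_mul, one_mul]
  rw [this, Res.left_smul, hs, zero_smul, BT.tmul_zero]
  exact zero_mem _

/-- The map `a ↦ x a` as a right `R`-linear map. -/
noncomputable def actOn (x : Res β α T) : Res α α A →ₗ[Rᵐᵒᵖ] Res β α T where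
  toFun a := op ((Res.of α α A).symm a) • x
  map_add' _ _ := by rw [map_add, op_add, add_smul]
  map_smul' r a := mul_smul (op (α r.unop)) (op ((Res.of α α A).symm a)) x

/-- The map `b ↦ b z` as a left `S`-linear map. -/
noncomputable def actOnLeft (z : Res β α T) : Res β β B →ₗ[S] Res β α T where
  toFun b := (Res.of β β B).symm b • z
  map_add' _ _ := by rw [map_add, add_smul]
  map_smul' s b := mul_smul (β s) ((Res.of β β B).symm b) z

variable (H : Herd α β T T')

/-- For `c ∈ C` the equaliser condition reads `xiC c = 1 ⊗ c`; letting the factor in `A` act on `x`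
gives back `x ⊗ c`. The right-hand side is additive in an arbitrary `c`, so it may be computed on
pure tensors that do not lie in `C`. -/
theorem tmul_eq_of_mem_C {c : TW α β T T'} (hc : c ∈ H.C) (x : Res β α T) :
    BT.tmul R x c = BT.map (actOn x) LinearMap.id (BT.assoc (H.xiC c)) := by
  rw [show H.xiC c = zetaC α β T T' c from hc]
  refine BT.hom_congr (f := BT.tmulLeft (TW α β T T') x)
    (g := ((BT.map (actOn x) LinearMap.id).comp BT.assoc).comp (zetaC α β T T'))
    (fun y z => ?_) c
  exact congrArg (fun t => BT.tmul R t (BT.tmul S y z)) (one_smul Aᵐᵒᵖ x).symm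

/-- For a term `x' ⊗ y' ⊗ z'` of `γ z`, the coefficient `x ev (y ⊗ x')` equals `evHat (x ⊗ y) x'`,
and `evHat (x ⊗ y)` no longer involves that term. -/
theorem map_actOn_xiC (x : Res β α T) (y : Res α β T') (z : Res β α T) :
    BT.map (actOn x) LinearMap.id (BT.assoc (H.xiC (BT.tmul S y z))) =
      H.evHat (BT.tmul R x y) • BT.assoc (H.γ z) :=
  BT.hom_congr₃
    (f := ((BT.map (actOn x) LinearMap.id).comp BT.assoc).comp
      (H.evExt.toAddMonoidHom.comp (insertG y)))
    (g := (DistribSMul.toAddMonoidHom _ (H.evHat (BT.tmul R x y))).comp BT.assoc)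
    (fun x' y' z' => congrArg (fun t => BT.tmul R t (BT.tmul S y' z'))
      (H.evHat_smul_eq x y x').symm) (H.γ z)

/-- The descent principle for `C`: since `x ⊗ c` is a sum of elements `b • γ z` with `b ∈ B`, a
statement about `T ⊗ f` need only be checked on `B`-multiples of values of the shepherd. -/
theorem tmul_mem_of_mem_C {M : Type u} [AddCommGroup M] [Module R M] (f : TW α β T T' →ₗ[R] M)
    (X : AddSubgroup (BT R (Res β α T) M))
    (h : ∀ (b : B) (z : Res β α T), b • BT.map LinearMap.id f (BT.assoc (H.γ z)) ∈ X)
    {c : TW α β T T'} (hc : c ∈ H.C) (x : Res β α T) : BT.tmul R x (f c) ∈ X := by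
  have e : BT.tmul R x (f c) = BT.map LinearMap.id f (BT.tmul R x c) := rfl
  rw [e, H.tmul_eq_of_mem_C hc]
  refine BT.map_mem_of_tmul (f := (BT.map LinearMap.id f).comp
    (((BT.map (actOn x) LinearMap.id).comp BT.assoc).comp H.xiC)) (fun y z => ?_) c
  simp only [AddMonoidHom.comp_apply]
  rw [H.map_actOn_xiC, BT.map_id_smul]
  exact h _ _

theorem tmul_eq_of_mem_D {d : TV α β T T'} (hd : d ∈ H.D) (z : Res β α T) :
    BT.tmul S d z = BT.map LinearMap.id (actOnLeft z) (H.xiD d) := by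
  rw [show H.xiD d = zetaD α β T T' d from hd]
  exact congrArg (BT.tmul S d) (one_smul B z).symm

theorem map_actOnLeft_xiD (x : Res β α T) (y : Res α β T') (z : Res β α T) :
    BT.map LinearMap.id (actOnLeft z) (H.xiD (BT.tmul R x y)) =
      op (H.ev (BT.tmul S y z)) • H.γ x :=
  BT.hom_congr (f := ((BT.map LinearMap.id (actOnLeft z)).comp H.evHatExt.toAddMonoidHom).comp
      (BT.tmulRight (TG α β T T') y))
    (g := DistribSMul.toAddMonoidHom _ (op (H.ev (BT.tmul S y z))))
    (fun v x' => congrArg (BT.tmul S v) (H.evHat_smul_eq x' y z)) (H.γ x)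

/-- The descent principle for `D`: if `d = ∑ xᵢ ⊗ yᵢ` lies in `D`, then `d ⊗ z = ∑ γ xᵢ · ev (yᵢ ⊗
z)`. -/
theorem tmul_mem_of_mem_D {M : Type u} [AddCommGroup M] [Module Sᵐᵒᵖ M]
    (f : TV α β T T' →ₗ[Sᵐᵒᵖ] M) (X : AddSubgroup (BT S M (Res β α T)))
    (h : ∀ (a : A) (x : Res β α T), op a • BT.map f LinearMap.id (H.γ x) ∈ X)
    {d : TV α β T T'} (hd : d ∈ H.D) (z : Res β α T) : BT.tmul S (f d) z ∈ X := by
  have e : BT.tmul S (f d) z = BT.map f LinearMap.id (BT.tmul S d z) := rfl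
  rw [e, H.tmul_eq_of_mem_D hd]
  refine BT.map_mem_of_tmul (f := (BT.map f LinearMap.id).comp
    ((BT.map LinearMap.id (actOnLeft z)).comp H.xiD)) (fun x y => ?_) d
  simp only [AddMonoidHom.comp_apply]
  rw [H.map_actOnLeft_xiD, BT.map_id_op_smul]
  exact h _ _

theorem smul_mem_spanRight {M : Type u} [AddCommGroup M] [Module R M] (M₀ : Submodule R M) (b : B)
    {z : BT R (Res β α T) M} (hz : z ∈ BT.spanRight (Res β α T) M₀) :
    b • z ∈ BT.spanRight (Res β α T) M₀ :=
  BT.map_mem_of_mem_spanRight (DistribSMul.toAddMonoidHom (BT R (Res β α T) M) b) _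
    (fun x _ hm => BT.tmul_mem_spanRight (b • x) hm) hz

theorem op_smul_mem_spanLeft {M : Type u} [AddCommGroup M] [Module Sᵐᵒᵖ M]
    (M₀ : Submodule Sᵐᵒᵖ M) (a : Aᵐᵒᵖ) {z : BT S M (Res β α T)}
    (hz : z ∈ BT.spanLeft (Res β α T) M₀) : a • z ∈ BT.spanLeft (Res β α T) M₀ :=
  BT.map_mem_of_mem_spanLeft (DistribSMul.toAddMonoidHom (BT S M (Res β α T)) a) _
    (fun _ hm x => BT.tmul_mem_spanLeft hm (a • x)) hz

/-- The evaluation maps `C` into `R`. -/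
theorem ev_mem_range (hR : FaithfullyFlatRight R (Res β α T)) {c : TW α β T T'} (hc : c ∈ H.C) :
    ∃ r, α r = H.ev c := by
  let f : R →ₗ[R] Res α α A :=
    { toFun := fun r => Res.of α α A (α r)
      map_add' := fun _ _ => by rw [map_add, map_add]
      map_smul' := fun r r' => map_mul α r r' }
  have : H.evLeft c ∈ LinearMap.range f := by
    -- It suffices that `x ⊗ ev c` comes from `T ⊗ α(R)`. Descent reduces this to `b • (z ⊗ 1)`, and
    -- `1 = α 1`.
    refine BT.mem_of_tmul_mem_spanRight hR (H.tmul_mem_of_mem_C H.evLeft _ (fun b z => ?_) hc)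
    rw [H.counit_right]
    exact smul_mem_spanRight _ b (BT.tmul_mem_spanRight z (LinearMap.mem_range.2 ⟨1, map_one α⟩))
  exact this

/-- The evaluation maps `D` into `S`. -/
theorem evHat_mem_range (hS : FaithfullyFlatLeft S (Res β α T)) {d : TV α β T T'} (hd : d ∈ H.D) :
    ∃ s, β s = H.evHat d := by
  let f : S →ₗ[Sᵐᵒᵖ] Res β β B :=
    { toFun := fun s => Res.of β β B (β s)
      map_add' := fun _ _ => by rw [map_add, map_add]
      map_smul' := fun s s' => map_mul β s' s.unop }
  have : H.evHatRight d ∈ LinearMap.range f := by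
    refine BT.mem_of_tmul_mem_spanLeft hS (H.tmul_mem_of_mem_D H.evHatRight _ (fun a x => ?_) hd)
    rw [H.counit_left]
    exact op_smul_mem_spanLeft _ (op a) (BT.tmul_mem_spanLeft (LinearMap.mem_range.2 ⟨1, map_one β⟩) x)
  exact this

/-! ### The values of `cov` and `covBar` -/

/-- `C ⊗_R T'` as a right `S`-submodule. -/
noncomputable def rightCT : Submodule Sᵐᵒᵖ (TX α β T T') :=
  { H.CT with
    smul_mem' := fun s u hu => by
      refine closure_stable (DistribSMul.toAddMonoidHom _ s) _ ?_ hu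
      rintro _ ⟨c, hc, y, rfl⟩
      exact AddSubgroup.subset_closure ⟨c, hc, s • y, rfl⟩ }

/-- `C ⊗_R T'` as a left `R`-submodule. -/
noncomputable def leftCT : Submodule R (TX α β T T') :=
  { H.CT with
    smul_mem' := fun r u hu => by
      refine closure_stable (DistribSMul.toAddMonoidHom _ r) _ ?_ hu
      rintro _ ⟨c, hc, y, rfl⟩
      exact AddSubgroup.subset_closure ⟨r • c, H.smul_mem_C r hc, y, rfl⟩ }

/-- `T' ⊗_S D` as a right `S`-submodule. -/
noncomputable def rightTD : Submodule Sᵐᵒᵖ (TX α β T T') :=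
  { H.TD with
    smul_mem' := fun s u hu => by
      refine closure_stable (DistribSMul.toAddMonoidHom _ s) _ ?_ hu
      rintro _ ⟨y, d, hd, rfl⟩
      exact AddSubgroup.subset_closure
        ⟨y, s • d, H.op_smul_mem_D s.unop hd, ((insertV y).map_smul s d).symm⟩ }

/-- `T' ⊗_S D` as a left `R`-submodule. -/
noncomputable def leftTD : Submodule R (TX α β T T') :=
  { H.TD with
    smul_mem' := fun r u hu => by
      refine closure_stable (DistribSMul.toAddMonoidHom _ r) _ ?_ hu
      rintro _ ⟨y, d, hd, rfl⟩
      exact AddSubgroup.subset_closure ⟨r • y, d, hd, smul_insertV r y d⟩ }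

/-- `C ⊗_R T' ⊗_S T` as a left `R`-submodule. -/
noncomputable def leftCTT : Submodule R (BT S (TX α β T T') (Res β α T)) :=
  { BT.spanLeft (Res β α T) H.rightCT with
    smul_mem' := fun r _ hz =>
      BT.map_mem_of_mem_spanLeft
        (DistribSMul.toAddMonoidHom (BT S (TX α β T T') (Res β α T)) r)
        (BT.spanLeft (Res β α T) H.rightCT)
        (fun _ hu x => BT.tmul_mem_spanLeft (M₀ := H.rightCT) (H.leftCT.smul_mem r hu) x) hz }

/-- `T ⊗_R T' ⊗_S D` as a right `S`-submodule. -/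
noncomputable def rightTTD : Submodule Sᵐᵒᵖ (BT R (Res β α T) (TX α β T T')) :=
  { BT.spanRight (Res β α T) H.leftTD with
    smul_mem' := fun s _ hz =>
      BT.map_mem_of_mem_spanRight
        (DistribSMul.toAddMonoidHom (BT R (Res β α T) (TX α β T T')) s)
        (BT.spanRight (Res β α T) H.leftTD)
        (fun x _ hu => BT.tmul_mem_spanRight (N₀ := H.leftTD) x (H.rightTD.smul_mem s hu)) hz }

theorem tmul_mem_CT {c : TW α β T T'} (hc : c ∈ H.C) (y : Res α β T') : BT.tmul R c y ∈ H.CT :=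
  AddSubgroup.subset_closure ⟨c, hc, y, rfl⟩

theorem insertV_mem_TD (y : Res α β T') {d : TV α β T T'} (hd : d ∈ H.D) : insertV y d ∈ H.TD :=
  AddSubgroup.subset_closure ⟨y, d, hd, rfl⟩

/-- After descent the claim concerns `(T ⊗ T' ⊗ γ) γ = (γ ⊗ T' ⊗ T) γ`, and the inner `γ` on the
right takes values in `T ⊗ C`. -/
theorem idγ_mem_CT (hR : FaithfullyFlatRight R (Res β α T)) {c : TW α β T T'} (hc : c ∈ H.C) :
    H.idγ c ∈ BT.spanLeft (Res β α T) H.rightCT := by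
  suffices h : H.idγLeft c ∈ H.leftCTT from h
  refine BT.mem_of_tmul_mem_spanRight hR (H.tmul_mem_of_mem_C H.idγLeft _ (fun b x => ?_) hc)
  refine smul_mem_spanRight _ b ?_
  rw [map_idγLeft_assoc, ← coassoc']
  refine BT.map_mem_of_tmul₃ (f := (splitExt α β T T').comp (BT.map H.γidRight LinearMap.id))
    (fun x y z => ?_) (H.γ x)
  let f : TW α β T T' →ₗ[R] BT S (TX α β T T') (Res β α T) :=
    (BT.mkR (K := R) z).comp (BT.mkR (K := R) y)
  have key : ∀ g : TG α β T T', splitExt α β T T' (BT.tmul S (BT.tmul R g y) z) =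
      BT.map LinearMap.id f (BT.assoc g) :=
    BT.hom_congr₃ (f := (splitExt α β T T').comp ((BT.tmulRight _ z).comp (BT.tmulRight _ y)))
      (g := (BT.map LinearMap.id f).comp BT.assoc) (fun _ _ _ => rfl)
  refine (key (H.γ x)).symm ▸ ?_
  refine BT.map_mem_of_mem_spanRight (BT.map LinearMap.id f) _ (fun x' c' hc' => ?_)
    (H.assoc_γ_mem hR.1 x)
  exact BT.tmul_mem_spanRight (N₀ := H.leftCTT) x'
    (BT.tmul_mem_spanLeft (M₀ := H.rightCT) (H.tmul_mem_CT hc' y) z)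

/-- Already `y ⊗ γ x` lies in `T' ⊗ D ⊗ T`, because `γ x` comes from `D ⊗ T`; no equaliser condition
on `w` enters. -/
theorem idγ_mem_TD (hS : FlatLeft S (Res β α T)) (w : TW α β T T') :
    H.idγ w ∈ BT.spanLeft (Res β α T) H.rightTD := by
  refine BT.map_mem_of_tmul (fun y x => ?_) w
  exact BT.map_mem_of_mem_spanLeft (insertG y) _ (fun d hd z =>
    BT.tmul_mem_spanLeft (M₀ := H.rightTD) (H.insertV_mem_TD y hd) z) (H.γ_mem hS x)

/-- Flatness of `T` over `S` makes the intersection of `(C ⊗ T') ⊗ T` and `(T' ⊗ D) ⊗ T` equal to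
the image of `Tbar ⊗ T`. -/
theorem idγ_mem_range (hR : FaithfullyFlatRight R (Res β α T)) (hS : FlatLeft S (Res β α T))
    {c : TW α β T T'} (hc : c ∈ H.C) : H.idγ c ∈ H.iotaA.range :=
  BT.map_mem_of_mem_spanLeft (AddMonoidHom.id _) H.iotaA.range
    (fun u hu z => ⟨BT.tmul S (⟨u, hu⟩ : H.Tbar) z, rfl⟩)
    (BT.mem_spanLeft_inf hS (H.idγ_mem_CT hR hc) (H.idγ_mem_TD hS c))

theorem splitX_γid_mem_CT (hR : FlatRight R (Res β α T)) (v : TV α β T T') :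
    splitX (H.γid v) ∈ BT.spanRight (Res β α T) H.leftCT := by
  refine BT.map_mem_of_tmul (f := splitX.toAddMonoidHom.comp H.γid) (fun x y => ?_) v
  have key : ∀ g : TG α β T T', splitX (BT.tmul R g y) =
      BT.map LinearMap.id (BT.mkR (R := R) (K := R) y) (BT.assoc g) :=
    BT.hom_congr₃ (f := splitX.toAddMonoidHom.comp (BT.tmulRight (TG α β T T') y))
      (g := (BT.map LinearMap.id (BT.mkR (R := R) (K := R) y)).comp BT.assoc) (fun _ _ _ => rfl)
  refine (key (H.γ x)).symm ▸ ?_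
  exact BT.map_mem_of_mem_spanRight (BT.map LinearMap.id _) _ (fun x' c hc =>
    BT.tmul_mem_spanRight (N₀ := H.leftCT) x' (H.tmul_mem_CT hc y)) (H.assoc_γ_mem hR x)

/-- Descent for `D` followed by coassociativity turns the claim into one about `(T ⊗ T' ⊗ γ) γ`,
where the last `γ` takes values in `D ⊗ T`. -/
theorem splitX_γid_mem_TD (hS : FaithfullyFlatLeft S (Res β α T)) {d : TV α β T T'}
    (hd : d ∈ H.D) : splitX (H.γid d) ∈ BT.spanRight (Res β α T) H.leftTD := by
  suffices h : (splitX.comp H.γidRight) d ∈ H.rightTTD from h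
  refine BT.mem_of_tmul_mem_spanLeft hS
    (H.tmul_mem_of_mem_D (splitX.comp H.γidRight) _ (fun a x => ?_) hd)
  refine op_smul_mem_spanLeft _ (op a) ?_
  have e : BT.map (splitX.comp H.γidRight) LinearMap.id (H.γ x) =
      BT.map splitX LinearMap.id (BT.map H.γidRight LinearMap.id (H.γ x)) :=
    BT.hom_congr (f := BT.map (splitX.comp H.γidRight) LinearMap.id)
      (g := (BT.map splitX LinearMap.id).comp (BT.map H.γidRight LinearMap.id))
      (fun _ _ => rfl) (H.γ x)
  rw [e, coassoc']
  refine BT.map_mem_of_tmul₃ (f := (BT.map splitX LinearMap.id).comp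
    ((joinG (TV α β T T')).comp (BT.map LinearMap.id H.γLeft))) (fun x y z => ?_) (H.γ x)
  refine BT.map_mem_of_mem_spanLeft ((BT.map splitX LinearMap.id).comp
    (insertG (BT.tmul R x y))) _ (fun d' hd' z' => ?_) (H.γ_mem hS.1 z)
  have key : ∀ v : TV α β T T', splitX (BT.mapL (L := S) (BT.mkL (L := R) (BT.tmul R x y)) v) =
      BT.tmul R x (insertV y v) :=
    BT.hom_congr (f := splitX.toAddMonoidHom.comp
        (BT.mapL (L := S) (BT.mkL (L := R) (BT.tmul R x y))).toAddMonoidHom)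
      (g := (BT.tmulLeft (TX α β T T') x).comp (insertV y).toAddMonoidHom) (fun _ _ => rfl)
  refine BT.tmul_mem_spanLeft (M₀ := H.rightTTD) ?_ z'
  refine (key d').symm ▸ ?_
  exact BT.tmul_mem_spanRight (N₀ := H.leftTD) x (H.insertV_mem_TD y hd')

theorem γid_mem_range (hR : FlatRight R (Res β α T)) (hS : FaithfullyFlatLeft S (Res β α T))
    {d : TV α β T T'} (hd : d ∈ H.D) : H.γid d ∈ H.iotaB.range := by
  rw [← joinX_splitX (H.γid d)]
  exact BT.map_mem_of_mem_spanRight joinX H.iotaB.range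
    (fun x u hu => ⟨BT.tmul R x (⟨u, hu⟩ : H.Tbar), rfl⟩)
    (BT.mem_spanRight_inf hR (H.splitX_γid_mem_CT hR d) (H.splitX_γid_mem_TD hS hd))

/-! ### Existence and uniqueness of the structure maps -/

theorem iotaA_injective (hS : FlatLeft S (Res β α T)) : Function.Injective H.iotaA :=
  hS _ _ H.inclRight Subtype.val_injective

theorem iotaB_injective (hR : FlatRight R (Res β α T)) : Function.Injective H.iotaB :=
  (Function.LeftInverse.injective splitX_joinX).comp (hR _ _ H.inclLeft Subtype.val_injective)

theorem exists_coherdMaps (hR : FaithfullyFlatRight R (Res β α T))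
    (hS : FaithfullyFlatLeft S (Res β α T)) : Nonempty H.CoherdMaps := by
  obtain ⟨εC, hεC⟩ := AddMonoidHom.exists_comp_eq_of_injective α.toAddMonoidHom
    (injective_left hR) (H.ev.comp H.C.subtype) (fun c => H.ev_mem_range hR c.2)
  obtain ⟨εD, hεD⟩ := AddMonoidHom.exists_comp_eq_of_injective β.toAddMonoidHom
    (injective_right hS) (H.evHat.comp H.D.subtype) (fun d => H.evHat_mem_range hS d.2)
  obtain ⟨cov, hcov⟩ := AddMonoidHom.exists_comp_eq_of_injective H.iotaA
    (H.iotaA_injective hS.1) (H.idγ.comp H.C.subtype) (fun c => H.idγ_mem_range hR hS.1 c.2)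
  obtain ⟨covBar, hcovBar⟩ := AddMonoidHom.exists_comp_eq_of_injective H.iotaB
    (H.iotaB_injective hR.1) (H.γid.comp H.D.subtype) (fun d => H.γid_mem_range hR.1 hS d.2)
  exact ⟨⟨εC, εD, cov, covBar, hεC, hεD, hcov, hcovBar⟩⟩

theorem coherdMaps_unique (hR : FaithfullyFlatRight R (Res β α T))
    (hS : FaithfullyFlatLeft S (Res β α T)) (d d' : H.CoherdMaps) : d = d' := by
  obtain ⟨εC, εD, cov, covBar, h₁, h₂, h₃, h₄⟩ := d
  obtain ⟨εC', εD', cov', covBar', h₁', h₂', h₃', h₄'⟩ := d'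
  obtain rfl : εC = εC' :=
    AddMonoidHom.ext fun c => injective_left hR ((h₁ c).trans (h₁' c).symm)
  obtain rfl : εD = εD' :=
    AddMonoidHom.ext fun c => injective_right hS ((h₂ c).trans (h₂' c).symm)
  obtain rfl : cov = cov' :=
    AddMonoidHom.ext fun c => H.iotaA_injective hS.1 ((h₃ c).trans (h₃' c).symm)
  obtain rfl : covBar = covBar' :=
    AddMonoidHom.ext fun c => H.iotaB_injective hR.1 ((h₄ c).trans (h₄' c).symm)
  rfl

end Herd

/-! ### The evaluation on `Tbar ⊗_S T` and the action on `T` -/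

namespace Herd

variable {R S A B : Type u} [Ring R] [Ring S] [Ring A] [Ring B] {α : R →+* A} {β : S →+* B}
  {T T' : Type u} [AddCommGroup T] [AddCommGroup T'] [Module B T] [Module Aᵐᵒᵖ T]
  [SMulCommClass B Aᵐᵒᵖ T] [Module A T'] [Module Bᵐᵒᵖ T'] [SMulCommClass A Bᵐᵒᵖ T']
  (H : Herd α β T T')

/-- By left `A`-linearity of `ev`, the map `evBarA` is `ev` composed with `h ⊗ T`. -/
theorem evBarA_tmul (u : H.Tbar) (z : Res β α T) :
    H.evBarA (BT.tmul S u z) = H.ev (BT.tmul S (H.evAct u.1) z) := by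
  exact BT.hom_congr (f := BT.lift (fun w y => H.ev w * H.ev (BT.tmul S y z))
      (fun _ _ _ => by rw [map_add, add_mul])
      (fun _ _ _ => by rw [BT.add_tmul, map_add, mul_add])
      (fun w r y => by rw [H.ev_op_smul, Res.left_smul, H.ev_left, mul_assoc]))
    (g := H.ev.comp ((BT.tmulRight (Res α β T') z).comp H.evAct))
    (fun w y => (H.ev_left (H.ev w) y z).symm) u.1

/-- The two compatibilities push both evaluations in `χ` to the right of `x`, so `q` acts on `T`
through `A`. This makes the product on `Tbar ⊗_S T` depend on its right factor only through
`evBarA`. -/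
theorem chiA_eq_smul (x : Res β α T) (p : H.PA) : H.chiA x p = op (H.evBarA p) • x := by
  induction p using BT.induction with
  | h₀ => rw [map_zero, map_zero, op_zero, zero_smul]
  | ha p q hp hq => rw [map_add, map_add, hp, hq, op_add, add_smul]
  | h u z =>
    rw [evBarA_tmul]
    change H.chi x z u.1 = _
    generalize u.1 = u
    induction u using BT.induction with
    | h₀ => simp only [map_zero, BT.zero_tmul, op_zero, zero_smul]
    | ha p q hp hq => rw [map_add, map_add, hp, hq, BT.add_tmul, map_add, op_add, add_smul]
    | h w y =>
      rw [chi_tmul]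
      exact congrArg (fun a => op a • x) (H.ev_left (H.ev w) y z).symm

theorem evHatMul_smul (x z : Res β α T) (u : TX α β T T') :
    H.evHatMul x u • z = H.chi x z u := by
  induction u using BT.induction with
  | h₀ => simp only [map_zero, zero_smul]
  | ha p q hp hq => rw [map_add, map_add, add_smul, hp, hq]
  | h w y' =>
    rw [chi_tmul]
    induction w using BT.induction with
    | h₀ => simp only [BT.zero_tmul, map_zero, zero_smul, zero_mul, op_zero]
    | ha v w hv hw => rw [BT.add_tmul, map_add, add_smul, hv, hw, map_add, add_mul, op_add, add_smul]
    | h y x' =>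
      change (H.evHat (BT.tmul R x y) * H.evHat (BT.tmul R x' y')) • z = _
      -- Both sides equal `evHat (x ⊗ y) x' ev (y' ⊗ z)`; the remaining discrepancy is the order of
      -- the two commuting actions.
      rw [mul_smul, op_mul, mul_smul, H.evHat_smul_eq x', ← H.evHat_smul_eq x, smul_comm]

theorem chiB_eq_smul (z : Res β α T) (p : H.PB) : H.chiB z p = H.evBarB p • z := by
  induction p using BT.induction with
  | h₀ => rw [map_zero, map_zero, zero_smul]
  | ha p q hp hq => rw [map_add, map_add, hp, hq, add_smul]
  | h x u => exact (H.evHatMul_smul x z u.1).symm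

/-- `T` is faithful over `A` if `ev` is surjective. -/
theorem eq_of_op_smul_eq (h : Function.Surjective H.ev) {a a' : A}
    (e : ∀ x : Res β α T, op a • x = op a' • x) : a = a' := by
  -- Write `1 = ev w` with `w = ∑ yᵢ ⊗ xᵢ`; then `a = ev w * a = ∑ ev (yᵢ ⊗ xᵢ a)` is determined by
  -- the action of `a` on `T`.
  obtain ⟨w, hw⟩ := h 1
  have := BT.hom_congr (f := (AddMonoidHom.mulRight a).comp H.ev)
    (g := (AddMonoidHom.mulRight a').comp H.ev) (fun y x => by
      simp only [AddMonoidHom.comp_apply, AddMonoidHom.mulRight_apply]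
      rw [← H.ev_right, ← H.ev_right, e]) w
  simpa [hw] using this

/-- `T` is faithful over `B` if `evHat` is surjective. -/
theorem eq_of_smul_eq (h : Function.Surjective H.evHat) {b b' : B}
    (e : ∀ x : Res β α T, b • x = b' • x) : b = b' := by
  obtain ⟨v, hv⟩ := h 1
  have := BT.hom_congr (f := (AddMonoidHom.mulLeft b).comp H.evHat)
    (g := (AddMonoidHom.mulLeft b').comp H.evHat) (fun x y => by
      simp only [AddMonoidHom.comp_apply, AddMonoidHom.coe_mulLeft]
      rw [← H.evHat_left, ← H.evHat_left, e]) v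
  simpa [hv] using this

/-- By associativity of `χ`, both sides act in the same way on the faithful module `T`. -/
theorem evBarA_mul (h : Function.Surjective H.ev) (p q : H.PA) :
    H.evBarA (p * q) = H.evBarA p * H.evBarA q :=
  H.eq_of_op_smul_eq h fun x => by
    rw [← chiA_eq_smul, chiA_mul, chiA_eq_smul, chiA_eq_smul, op_mul, mul_smul]

theorem evBarB_mul (h : Function.Surjective H.evHat) (p q : H.PB) :
    H.evBarB (p * q) = H.evBarB p * H.evBarB q :=
  H.eq_of_smul_eq h fun x => by
    rw [← chiB_eq_smul, chiB_mul, chiB_eq_smul, chiB_eq_smul, mul_smul]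

theorem evBarA_smul (h : Function.Surjective H.ev) (r : R) (p : H.PA) :
    H.evBarA (r • p) = α r * H.evBarA p :=
  H.eq_of_op_smul_eq h fun x => by
    rw [← chiA_eq_smul, ← chiA_op_smul, chiA_eq_smul, Res.right_smul, op_mul, mul_smul]

theorem evBarB_op_smul (h : Function.Surjective H.evHat) (s : S) (p : H.PB) :
    H.evBarB (op s • p) = H.evBarB p * β s :=
  H.eq_of_smul_eq h fun x => by
    rw [← chiB_eq_smul, ← chiB_smul, chiB_eq_smul, Res.left_smul, mul_smul]

theorem evBarA_big_smul (a : A) (p : H.PA) : H.evBarA (op a • p) = H.evBarA p * a :=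
  BT.hom_congr (f := H.evBarA.comp (DistribSMul.toAddMonoidHom H.PA (op a)))
    (g := (AddMonoidHom.mulRight a).comp H.evBarA) (fun u z => by
      simp only [AddMonoidHom.comp_apply, DistribSMul.toAddMonoidHom_apply, BT.op_smul_tmul,
        AddMonoidHom.mulRight_apply]
      rw [evBarA_tmul, evBarA_tmul, H.ev_right]) p

theorem evBarB_big_smul (h : Function.Surjective H.evHat) (b : B) (p : H.PB) :
    H.evBarB (b • p) = b * H.evBarB p :=
  BT.hom_congr (f := H.evBarB.comp (DistribSMul.toAddMonoidHom H.PB b))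
    (g := (AddMonoidHom.mulLeft b).comp H.evBarB) (fun x u => H.eq_of_smul_eq h fun z => by
      change H.evHatMul (b • x) u.1 • z = (b * H.evHatMul x u.1) • z
      rw [mul_smul, evHatMul_smul, evHatMul_smul]
      exact BT.hom_congr (f := H.chi (b • x) z)
        (g := (DistribSMul.toAddMonoidHom _ b).comp (H.chi x z)) (fun w y => by
          simp only [AddMonoidHom.comp_apply, chi_tmul, DistribSMul.toAddMonoidHom_apply]
          exact (smul_comm b _ x).symm) u.1) p

/-! ### Kernel and image of the evaluation; the isomorphisms -/

namespace CoherdMaps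

variable {H} (d : H.CoherdMaps)

/-- The counit law makes `cov c` act on `T` as right multiplication by `ev c`, and faithfulness
concludes. -/
theorem evBarA_cov (h : Function.Surjective H.ev) (c : H.C) : H.evBarA (d.cov c) = H.ev c.1 :=
  H.eq_of_op_smul_eq h fun x => by rw [← chiA_eq_smul, chiA_eq, d.cov_eq, chiTX_idγ]

theorem evBarB_covBar (h : Function.Surjective H.evHat) (c : H.D) :
    H.evBarB (d.covBar c) = H.evHat c.1 :=
  H.eq_of_smul_eq h fun x => by rw [← chiB_eq_smul, chiB_eq, d.covBar_eq, chiTG_γid]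

theorem evBarA_eq_zero (h : Function.Surjective H.ev) {p : H.PA} (hp : p ∈ d.imA) :
    H.evBarA p = 0 := by
  refine (AddSubgroup.closure_le H.evBarA.ker).2 ?_ hp
  rintro _ ⟨c, q, rfl⟩
  exact (H.evBarA.mem_ker).2 (by
    rw [map_sub, H.evBarA_mul h, H.evBarA_smul h, d.evBarA_cov h, d.εC_eq, sub_self])

theorem evBarB_eq_zero (h : Function.Surjective H.evHat) {p : H.PB} (hp : p ∈ d.imB) :
    H.evBarB p = 0 := by
  refine (AddSubgroup.closure_le H.evBarB.ker).2 ?_ hp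
  rintro _ ⟨c, q, rfl⟩
  exact (H.evBarB.mem_ker).2 (by
    rw [map_sub, H.evBarB_mul h, H.evBarB_op_smul h, d.evBarB_covBar h, d.εD_eq, sub_self])

theorem mul_eq_zero_of_evBarA {q : H.PA} (hq : H.evBarA q = 0) (p : H.PA) : p * q = 0 :=
  BT.hom_congr (f := H.mulA q) (g := 0) (fun u x => by
    change BT.tmul S u (H.chiA x q) = 0
    rw [chiA_eq_smul, hq, op_zero, zero_smul, BT.tmul_zero]) p

theorem mul_eq_zero_of_evBarB {p : H.PB} (hp : H.evBarB p = 0) (q : H.PB) : p * q = 0 :=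
  BT.hom_congr (f := H.mulB p) (g := 0) (fun x u => by
    change BT.tmul R (H.chiB x p) u = 0
    rw [chiB_eq_smul, hp, zero_smul, BT.zero_tmul]) q

/-- With `ev c = 1`, the relation for `c` and `p` is `cov c * p - p`. Its first term vanishes
because `p` acts as zero on `T`. -/
theorem mem_imA (hR : FaithfullyFlatRight R (Res β α T)) {p : H.PA} (hp : H.evBarA p = 0) :
    p ∈ d.imA := by
  obtain ⟨c, hc, e⟩ := H.exists_ev_eq_one hR
  have h₁ : d.εC ⟨c, hc⟩ = 1 := injective_left hR (by rw [d.εC_eq, e, map_one])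
  have h₂ : d.cov ⟨c, hc⟩ * p - d.εC ⟨c, hc⟩ • p ∈ d.imA :=
    AddSubgroup.subset_closure ⟨_, _, rfl⟩
  rw [h₁, one_smul, mul_eq_zero_of_evBarA hp, zero_sub] at h₂
  exact neg_mem_iff.1 h₂

/-- On this side it is the left factor that matters: `p * covBar c` vanishes, and the relation for
`c` reduces to `-p`. -/
theorem mem_imB (hS : FaithfullyFlatLeft S (Res β α T)) {p : H.PB} (hp : H.evBarB p = 0) :
    p ∈ d.imB := by
  obtain ⟨c, hc, e⟩ := H.exists_evHat_eq_one hS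
  have h₁ : d.εD ⟨c, hc⟩ = 1 := injective_right hS (by rw [d.εD_eq, e, map_one])
  have h₂ : p * d.covBar ⟨c, hc⟩ - op (d.εD ⟨c, hc⟩) • p ∈ d.imB :=
    AddSubgroup.subset_closure ⟨_, _, rfl⟩
  rw [h₁, op_one, one_smul, mul_eq_zero_of_evBarB hp, zero_sub] at h₂
  exact neg_mem_iff.1 h₂

theorem evBarA_surjective (d : H.CoherdMaps) (hR : FaithfullyFlatRight R (Res β α T))
    (h : Function.Surjective H.ev) : Function.Surjective H.evBarA := fun a => by
  obtain ⟨c, hc, e⟩ := H.exists_ev_eq_one hR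
  -- Right `A`-linearity sends `cov c · a` to `ev c * a = a`.
  exact ⟨op a • d.cov ⟨c, hc⟩, by rw [evBarA_big_smul, d.evBarA_cov h, e, one_mul]⟩

theorem evBarB_surjective (d : H.CoherdMaps) (hS : FaithfullyFlatLeft S (Res β α T))
    (h : Function.Surjective H.evHat) : Function.Surjective H.evBarB := fun b => by
  obtain ⟨c, hc, e⟩ := H.exists_evHat_eq_one hS
  exact ⟨b • d.covBar ⟨c, hc⟩, by rw [H.evBarB_big_smul h, d.evBarB_covBar h, e, mul_one]⟩

theorem piA_surjective : Function.Surjective d.piA := Quotient.mk_surjective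

theorem piB_surjective : Function.Surjective d.piB := Quotient.mk_surjective

/-- For a tame herd `νA : A' → A` exists and is bijective. -/
theorem exists_νA (hH : H.IsTame) : ∃ νA : d.A' →ₙ+* A,
    (∀ p : H.PA, νA (d.piA p) = H.evBarA p) ∧ Function.Bijective νA := by
  let f : H.PA →ₙ+* A := { H.evBarA with map_mul' := H.evBarA_mul hH.1 }
  -- The ideal has `imA` as its underlying subgroup, and `imA` is exactly the kernel of `evBarA`:
  -- this inclusion gives the map on `A'`, the reverse one its injectivity.
  have hf : ∀ p ∈ d.idealA, f p = 0 := fun p hp =>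
    d.evBarA_eq_zero hH.1 ((TwoSidedIdeal.mem_mk' _ _ _ _ _ _ _).1 hp)
  refine ⟨d.idealA.quotientLift f hf, fun _ => rfl, ?_, fun a => ?_⟩
  · refine (injective_iff_map_eq_zero _).2 fun a ha => ?_
    obtain ⟨p, rfl⟩ := d.piA_surjective a
    exact (d.piA_eq_zero_iff p).2 (d.mem_imA hH.2.2.1 ha)
  · obtain ⟨p, hp⟩ := d.evBarA_surjective hH.2.2.1 hH.1 a
    exact ⟨d.piA p, hp⟩

/-- For a tame herd `νB : B' → B` exists and is bijective. -/
theorem exists_νB (hH : H.IsTame) : ∃ νB : d.B' →ₙ+* B,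
    (∀ p : H.PB, νB (d.piB p) = H.evBarB p) ∧ Function.Bijective νB := by
  let f : H.PB →ₙ+* B := { H.evBarB with map_mul' := H.evBarB_mul hH.2.1 }
  have hf : ∀ p ∈ d.idealB, f p = 0 := fun p hp =>
    d.evBarB_eq_zero hH.2.1 ((TwoSidedIdeal.mem_mk' _ _ _ _ _ _ _).1 hp)
  refine ⟨d.idealB.quotientLift f hf, fun _ => rfl, ?_, fun b => ?_⟩
  · refine (injective_iff_map_eq_zero _).2 fun b hb => ?_
    obtain ⟨p, rfl⟩ := d.piB_surjective b
    exact (d.piB_eq_zero_iff p).2 (d.mem_imB hH.2.2.2 hb)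
  · obtain ⟨p, hp⟩ := d.evBarB_surjective hH.2.2.2 hH.2.1 b
    exact ⟨d.piB p, hp⟩

end CoherdMaps

end Herd

/-! ### Units and the main theorem -/

theorem NonUnitalRingHom.exists_one_of_bijective {P A : Type*} [NonUnitalRing P] [Ring A]
    (f : P →ₙ+* A) (hf : Function.Bijective f) : ∃ e : P, ∀ a : P, e * a = a ∧ a * e = a := by
  obtain ⟨e, he⟩ := hf.2 1
  exact ⟨e, fun a => ⟨hf.1 (by rw [map_mul, he, one_mul]), hf.1 (by rw [map_mul, he, mul_one])⟩⟩

theorem mainTheorem6 {R S A B : Type u} [Ring R] [Ring S] [Ring A] [Ring B]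
    (α : R →+* A) (β : S →+* B) (T T' : Type u) [AddCommGroup T] [AddCommGroup T']
    [Module B T] [Module Aᵐᵒᵖ T] [SMulCommClass B Aᵐᵒᵖ T]
    [Module A T'] [Module Bᵐᵒᵖ T'] [SMulCommClass A Bᵐᵒᵖ T']
    (H : Herd α β T T') (hH : H.IsTame) :
    ∃ d : H.CoherdMaps, (∀ d' : H.CoherdMaps, d' = d) ∧
      ∃ (νA : d.A' →ₙ+* A) (νB : d.B' →ₙ+* B),
        (∀ p : H.PA, νA (d.piA p) = H.evBarA p) ∧
        (∀ p : H.PB, νB (d.piB p) = H.evBarB p) ∧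
        (Function.Bijective H.h →
          Function.Bijective νA ∧ Function.Bijective νB ∧
          (∃ e : d.A', ∀ a : d.A', e * a = a ∧ a * e = a) ∧
          (∃ e : d.B', ∀ b : d.B', e * b = b ∧ b * e = b)) ∧
        (FlatLeft R (Res α β T') → FlatRight S (Res α β T') →
          H.Tbar = H.TD → H.TD = H.CT →
          Function.Bijective νA ∧ Function.Bijective νB) := by
  obtain ⟨d⟩ := H.exists_coherdMaps hH.2.2.1 hH.2.2.2
  obtain ⟨νA, hA, bA⟩ := d.exists_νA hH
  obtain ⟨νB, hB, bB⟩ := d.exists_νB hH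
  exact ⟨d, fun d' => H.coherdMaps_unique hH.2.2.1 hH.2.2.2 d' d, νA, νB, hA, hB,
    fun _ => ⟨bA, bB, νA.exists_one_of_bijective bA, νB.exists_one_of_bijective bB⟩,
    fun _ _ _ _ => ⟨bA, bB⟩⟩
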